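/- Let $\mathbf F_q$ be a finite field with $q$ elements, let $\pi\in\mathbf F_q[x]$ be monic and irreducible of degree $\delta$, and let $K_\pi$ be the completion of $\mathbf F_q(x)$ for the absolute value with $|\pi^n\alpha/\alpha'|_\pi=q^{-n\delta}$ ($\pi\nmid\alpha\alpha'$, where $\alpha,\alpha'\in\mathbf F_q[x]$). Let $\Omega_\pi$ be the completion of an algebraic closure of $K_\pi$ with respect to the extended absolute value, and $O_\pi=\{t\in K_\pi:|t|_\pi\le 1\}$. For a function $u:O_\pi\to\Omega_\pi$ put $(\Delta u)(t)=u(xt)-x\,u(t)$, $(du)(t)=\big((\Delta u)(t)\big)^{1/q}$ and $(\tau u)(t)=u(t)^q$. Put $[n]=x^{q^n}-x$, $D_0=1$, $D_i=[i][i-1]^q\cdots[1]^{q^{i-1}}$, $L_i=[i][i-1]\cdots[1]$, and let $f_i(t)=D_i^{-1}\prod_{\omega\in\mathbf F_q[x],\ \deg\omega<i}(t-\omega)$ for $i\ge 1$, $f_0(t)=t$, be the normalized Carlitz polynomials. **Theorem 1.** The equation $(1-\tau)du(t)=t$ ($t\in O_\pi$) has exactly $q^\delta$ continuous $\mathbf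 F_q$-linear solutions $u:O_\pi\to\Omega_\pi$ that satisfy $$u(t)=\sum_{n=1}^\infty\frac{t^{q^n}}{[n]}\qquad\text{for } |t|_\pi\le q^{-\delta}.$$ Each of these solutions has a unique uniformly convergent expansion $u=\sum_{i=0}^\infty c_if_i$ with $c_i\in\Omega_\pi$, and its coefficients satisfy $$c_1^q-c_1+1=0,\qquad c_{i+1}^q-c_{i+1}+[i]^qc_i^q=0\quad(1\le i\le\delta-1),$$ $$c_n=\sum_{j=0}^\infty\big(c_{n-1}[n-1]\big)^{q^{j+1}}\quad(n\ge\delta+1),\qquad c_0=\sum_{i=1}^\infty(-1)^{i+1}\frac{c_i}{L_i}.$$ Conversely, $c_1,\dots,c_\delta\in\Omega_\pi$ may be arbitrary solutions of the equations in the first line: for every such choice there is exactly one sequence $(c_i)_{i\ge 0}$ that begins with the chosen $c_1,\dots,c_\delta$ and satisfies the relations in the second line (all series involved being convergent), and for every sequence satisfying all these relations the series $\sum_i c_if_i$ converges uniformly on $O_\pi$ to one of these solutions. -/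

import Mathlib

open scoped Polynomial NNReal Topology

noncomputable section

namespace CarlitzPlace

/-! ### The local field `K_π` and the field `Ω_π` -/

/-- The place of `F[X]` attached to an irreducible polynomial `π`: the prime ideal `(π)`. -/
def place {F : Type*} [Field F] (π : F[X]) [hπ : Fact (Irreducible π)] :
    IsDedekindDomain.HeightOneSpectrum F[X] where
  asIdeal := Ideal.span {π}
  isPrime := (Ideal.span_singleton_prime hπ.out.ne_zero).2 hπ.out.prime
  ne_bot := by simpa using hπ.out.ne_zero

theorem one_lt_base {F : Type*} [Field F] [Fintype F] (π : F[X]) [hπ : Fact (Irreducible π)] :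
    (1 : ℝ≥0) < (Fintype.card F : ℝ≥0) ^ π.natDegree :=
  one_lt_pow₀ (by exact_mod_cast Fintype.one_lt_card) hπ.out.natDegree_pos.ne'

/-- The absolute value on `F(x)` with `|π ^ n * α / α'| = q ^ (-n δ)` when `π ∤ α, α'`, where
`q = #F` and `δ = deg π`. -/
def absPi {F : Type*} [Field F] [Fintype F] (π : F[X]) [Fact (Irreducible π)] :
    AbsoluteValue (RatFunc F) ℝ :=
  (place π).adicAbv (one_lt_base π)

/-- `K_π`, the completion of `F(x)` with respect to `absPi π`. -/
abbrev KPi {F : Type*} [Field F] [Fintype F] (π : F[X]) [Fact (Irreducible π)] : Type _ :=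
  (absPi π).Completion

/-- The embedding of `F(x)` into its completion `K_π`. -/
def ratToK {F : Type*} [Field F] [Fintype F] (π : F[X]) [Fact (Irreducible π)] :
    RatFunc F →+* KPi π :=
  (UniformSpace.Completion.coeRingHom (α := WithAbs (absPi π))).comp
    (WithAbs.equiv (absPi π)).symm.toRingHom

/-- The embedding of `F[x]` into `K_π`. -/
def polyToK {F : Type*} [Field F] [Fintype F] (π : F[X]) [Fact (Irreducible π)] :
    F[X] →+* KPi π :=
  (ratToK π).comp (algebraMap F[X] (RatFunc F))

theorem norm_ratToK {F : Type*} [Field F] [Fintype F] (π : F[X]) [Fact (Irreducible π)]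
    (r : RatFunc F) : ‖ratToK π r‖ = absPi π r :=
  UniformSpace.Completion.norm_coe (WithAbs.toAbs (absPi π) r)

theorem norm_polyToK_le_one {F : Type*} [Field F] [Fintype F] (π : F[X]) [Fact (Irreducible π)]
    (f : F[X]) : ‖polyToK π f‖ ≤ 1 := by
  rw [polyToK, RingHom.comp_apply, norm_ratToK]
  exact (place π).adicAbv_coe_le_one (one_lt_base π) f

theorem norm_polyToK_self {F : Type*} [Field F] [Fintype F] (π : F[X])
    [hπ : Fact (Irreducible π)] :
    ‖polyToK π π‖ = ((Fintype.card F : ℝ) ^ π.natDegree)⁻¹ := by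
  rw [polyToK, RingHom.comp_apply, norm_ratToK]
  have h : (place π).intValuation π = WithZero.exp (-1 : ℤ) :=
    (place π).intValuation_singleton hπ.out.ne_zero rfl
  have h2 : absPi π (algebraMap F[X] (RatFunc F) π) =
      (WithZeroMulInt.toNNReal (ne_zero_of_lt (one_lt_base π)) (WithZero.exp (-1 : ℤ)) : ℝ≥0) := by
    rw [← h, ← (place π).valuation_of_algebraMap (K := RatFunc F)]
    rfl
  rw [h2]
  have h3 : WithZeroMulInt.toNNReal (ne_zero_of_lt (one_lt_base π)) (WithZero.exp (-1 : ℤ)) =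
      ((Fintype.card F : ℝ≥0) ^ π.natDegree) ^ (-1 : ℤ) :=
    WithZeroMulInt.toNNReal_neg_apply _ (WithZero.coe_ne_zero)
  rw [h3]
  simp

instance instUltrametricKPi {F : Type*} [Field F] [Fintype F] (π : F[X])
    [Fact (Irreducible π)] : IsUltrametricDist (KPi π) := by
  refine IsUltrametricDist.isUltrametricDist_of_forall_norm_add_le_max_norm fun a b => ?_
  refine UniformSpace.Completion.induction_on₂ a b ?_ fun a b => ?_
  · exact isClosed_le (by fun_prop) (by fun_prop)
  · rw [← UniformSpace.Completion.coe_add, UniformSpace.Completion.norm_coe,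
      UniformSpace.Completion.norm_coe, UniformSpace.Completion.norm_coe]
    exact (place π).isNonarchimedean_adicAbv (one_lt_base π) a.ofAbs b.ofAbs

instance instNontriviallyNormedFieldKPi {F : Type*} [Field F] [Fintype F] (π : F[X])
    [hπ : Fact (Irreducible π)] : NontriviallyNormedField (KPi π) where
  non_trivial := by
    refine ⟨(polyToK π π)⁻¹, ?_⟩
    rw [norm_inv, norm_polyToK_self, inv_inv]
    exact_mod_cast one_lt_base π

/-- An algebraic closure of `K_π`. -/
abbrev KPiAlg {F : Type*} [Field F] [Fintype F] (π : F[X]) [Fact (Irreducible π)] : Type _ :=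
  AlgebraicClosure (KPi π)

/-- The algebraic closure of `K_π` carries the unique extension of the absolute value. -/
instance instNormedFieldKPiAlg {F : Type*} [Field F] [Fintype F] (π : F[X])
    [Fact (Irreducible π)] : NormedField (KPiAlg π) :=
  spectralNorm.normedField (KPi π) (KPiAlg π)

instance instNormedAlgebraKPiAlg {F : Type*} [Field F] [Fintype F] (π : F[X])
    [Fact (Irreducible π)] : NormedAlgebra (KPi π) (KPiAlg π) :=
  spectralNorm.normedAlgebra (KPi π) (KPiAlg π)

/-- `Ω_π`, the completion of an algebraic closure of `K_π`. -/
abbrev OmegaPi {F : Type*} [Field F] [Fintype F] (π : F[X]) [Fact (Irreducible π)] : Type _ :=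
  UniformSpace.Completion (KPiAlg π)

/-- The embedding of `K_π` into `Ω_π`. -/
def kToOmega {F : Type*} [Field F] [Fintype F] (π : F[X]) [Fact (Irreducible π)] :
    KPi π →+* OmegaPi π :=
  (UniformSpace.Completion.coeRingHom (α := KPiAlg π)).comp (algebraMap (KPi π) (KPiAlg π))

/-- The embedding of `F[x]` into `Ω_π`. -/
def polyToOmega {F : Type*} [Field F] [Fintype F] (π : F[X]) [Fact (Irreducible π)] :
    F[X] →+* OmegaPi π :=
  (kToOmega π).comp (polyToK π)

theorem norm_kToOmega {F : Type*} [Field F] [Fintype F] (π : F[X]) [Fact (Irreducible π)]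
    (t : KPi π) : ‖kToOmega π t‖ = ‖t‖ := by
  rw [kToOmega, RingHom.comp_apply]
  exact (UniformSpace.Completion.norm_coe _).trans (norm_algebraMap' _ t)

/-- In `Ω_π` every element has a unique `q`-th root. -/
theorem existsUnique_root {F : Type*} [Field F] [Fintype F] (π : F[X]) [Fact (Irreducible π)]
    (z : OmegaPi π) : ∃! w : OmegaPi π, w ^ Fintype.card F = z := by
  obtain ⟨p, hp⟩ := CharP.exists F
  obtain ⟨n, hpp, hn⟩ := FiniteField.card F p
  have : Fact p.Prime := ⟨hpp⟩
  have : CharP (OmegaPi π) p :=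
    charP_of_injective_ringHom ((polyToOmega π).comp Polynomial.C).injective p
  have hsub : ∀ a b : OmegaPi π,
      (a - b) ^ Fintype.card F = a ^ Fintype.card F - b ^ Fintype.card F := by
    intro a b
    rw [hn]
    exact sub_pow_char_pow a b _
  have hq : Fintype.card F ≠ 0 := Fintype.card_ne_zero
  have hclosed : IsClosed (Set.range fun w : OmegaPi π => w ^ Fintype.card F) := by
    refine IsSeqClosed.isClosed fun a z ha hz => ?_
    choose w hw using ha
    have hw : ∀ k, w k ^ Fintype.card F = a k := hw
    have hcau : CauchySeq w := by
      rw [Metric.cauchySeq_iff]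
      intro ε hε
      obtain ⟨N, hN⟩ := Metric.cauchySeq_iff.1 hz.cauchySeq (ε ^ Fintype.card F) (by positivity)
      refine ⟨N, fun m hm k hk => ?_⟩
      have h1 := hN m hm k hk
      rw [dist_eq_norm, ← hw, ← hw, ← hsub, norm_pow] at h1
      rw [dist_eq_norm]
      exact lt_of_pow_lt_pow_left₀ _ hε.le h1
    obtain ⟨y, hy⟩ := cauchySeq_tendsto_of_complete hcau
    refine ⟨y, tendsto_nhds_unique (f := a) (l := Filter.atTop) ?_ hz⟩
    have h2 := hy.pow (Fintype.card F)
    simpa only [hw] using h2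
  have hsurj : ∀ z : OmegaPi π, z ∈ Set.range fun w : OmegaPi π => w ^ Fintype.card F := by
    intro z
    refine UniformSpace.Completion.induction_on z hclosed fun a => ?_
    obtain ⟨b, hb⟩ := IsAlgClosed.exists_pow_nat_eq a (Nat.pos_of_ne_zero hq)
    refine ⟨UniformSpace.Completion.coeRingHom b, ?_⟩
    simp only
    rw [← map_pow, hb]
    rfl
  obtain ⟨w, hw⟩ := hsurj z
  refine ⟨w, hw, fun y hy => ?_⟩
  have h3 : (y - w) ^ Fintype.card F = 0 := by
    rw [hsub, hy]
    exact sub_eq_zero.2 hw.symm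
  exact sub_eq_zero.1 (pow_eq_zero_iff hq |>.1 h3)

/-- The `q`-th root on `Ω_π`. -/
def qRoot {F : Type*} [Field F] [Fintype F] (π : F[X]) [Fact (Irreducible π)]
    (z : OmegaPi π) : OmegaPi π :=
  (existsUnique_root π z).choose

theorem qRoot_pow {F : Type*} [Field F] [Fintype F] (π : F[X]) [Fact (Irreducible π)]
    (z : OmegaPi π) : qRoot π z ^ Fintype.card F = z :=
  (existsUnique_root π z).choose_spec.1

/-! ### The disk `O_π`, `F`-linear functions and the Carlitz derivative -/

/-- The disk `O_π = {t ∈ K_π : |t| ≤ 1}`, a subring of `K_π`. -/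
def OPi {F : Type*} [Field F] [Fintype F] (π : F[X]) [Fact (Irreducible π)] :
    Subring (KPi π) where
  carrier := {t | ‖t‖ ≤ 1}
  mul_mem' {a b} ha hb := by
    have ha : ‖a‖ ≤ 1 := ha
    have hb : ‖b‖ ≤ 1 := hb
    change ‖a * b‖ ≤ 1
    rw [norm_mul]
    exact mul_le_one₀ ha (norm_nonneg b) hb
  one_mem' := by simp
  add_mem' {a b} ha hb := (IsUltrametricDist.norm_add_le_max a b).trans (max_le ha hb)
  zero_mem' := by simp
  neg_mem' {a} ha := by
    have ha : ‖a‖ ≤ 1 := ha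
    change ‖-a‖ ≤ 1
    rwa [norm_neg]

/-- The embedding of `F[x]` into `O_π`. -/
def polyToO {F : Type*} [Field F] [Fintype F] (π : F[X]) [Fact (Irreducible π)] :
    F[X] →+* OPi π :=
  (polyToK π).codRestrict (OPi π) (norm_polyToK_le_one π)

/-- The embedding of `O_π` into `Ω_π`. -/
def oToOmega {F : Type*} [Field F] [Fintype F] (π : F[X]) [Fact (Irreducible π)] :
    OPi π →+* OmegaPi π :=
  (kToOmega π).comp (OPi π).subtype

/-- `F`-linearity of a function `O_π → Ω_π`. -/
def IsFqLinear {F : Type*} [Field F] [Fintype F] (π : F[X]) [Fact (Irreducible π)]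
    (u : OPi π → OmegaPi π) : Prop :=
  (∀ s t, u (s + t) = u s + u t) ∧
    ∀ (α : F) (t : OPi π),
      u (polyToO π (Polynomial.C α) * t) = polyToOmega π (Polynomial.C α) * u t

/-- Carlitz's difference operator `(Δ u)(t) = u(x t) - x u(t)`. -/
def carlitzDelta {F : Type*} [Field F] [Fintype F] (π : F[X]) [Fact (Irreducible π)]
    (u : OPi π → OmegaPi π) : OPi π → OmegaPi π :=
  fun t => u (polyToO π Polynomial.X * t) - polyToOmega π Polynomial.X * u t

/-- Carlitz's derivative `d = q-th root ∘ Δ`. -/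
def carlitzD {F : Type*} [Field F] [Fintype F] (π : F[X]) [Fact (Irreducible π)]
    (u : OPi π → OmegaPi π) : OPi π → OmegaPi π :=
  fun t => qRoot π (carlitzDelta π u t)

/-- The operator `τ u = u ^ q`. -/
def frobTau {F : Type*} [Field F] [Fintype F] (π : F[X]) [Fact (Irreducible π)]
    (u : OPi π → OmegaPi π) : OPi π → OmegaPi π :=
  fun t => u t ^ Fintype.card F

/-- The equation `(1 - τ) d u (t) = t` on `O_π`. -/
def SolvesLogEquation {F : Type*} [Field F] [Fintype F] (π : F[X]) [Fact (Irreducible π)]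
    (u : OPi π → OmegaPi π) : Prop :=
  ∀ t : OPi π, carlitzD π u t - frobTau π (carlitzD π u) t = oToOmega π t

/-! ### Carlitz's `[n]`, `D_n`, `L_n` and the normalized Carlitz polynomials -/

/-- `[n] = x ^ (q ^ n) - x`. -/
def bracket (F : Type*) [Field F] [Fintype F] (n : ℕ) : F[X] :=
  Polynomial.X ^ Fintype.card F ^ n - Polynomial.X

/-- `D_n = [n] [n-1] ^ q ⋯ [1] ^ (q ^ (n-1))`, with `D_0 = 1`. -/
def carlitzFactorial (F : Type*) [Field F] [Fintype F] (n : ℕ) : F[X] :=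
  ∏ j ∈ Finset.range n, bracket F (n - j) ^ Fintype.card F ^ j

/-- `L_n = [n] [n-1] ⋯ [1]`. -/
def carlitzL (F : Type*) [Field F] [Fintype F] (n : ℕ) : F[X] :=
  ∏ j ∈ Finset.range n, bracket F (j + 1)

instance instFintypeDegreeLT (F : Type*) [Field F] [Fintype F] (i : ℕ) :
    Fintype (Polynomial.degreeLT F i) :=
  Fintype.ofEquiv _ (Polynomial.degreeLTEquiv F i).symm.toEquiv

/-- `e_i(t) = ∏ (t - ω)` over all `ω ∈ F[x]` with `deg ω < i` (so `e_0(t) = t`). -/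
def carlitzE {F : Type*} [Field F] [Fintype F] (π : F[X]) [Fact (Irreducible π)]
    (i : ℕ) (t : KPi π) : KPi π :=
  ∏ ω : Polynomial.degreeLT F i, (t - polyToK π (ω : F[X]))

/-- The normalized Carlitz polynomial `f_i = e_i / D_i`, as a function on `O_π`. -/
def carlitzF {F : Type*} [Field F] [Fintype F] (π : F[X]) [Fact (Irreducible π)]
    (i : ℕ) (t : OPi π) : OmegaPi π :=
  kToOmega π (carlitzE π i t / polyToK π (carlitzFactorial F i))

/-! ### The solutions and the coefficient relations -/

/-- `u` coincides with the series `l_1(t) = ∑_{n ≥ 1} t ^ (q ^ n) / [n]` for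
`|t| ≤ q ^ (-δ)`. -/
def AgreesWithLog {F : Type*} [Field F] [Fintype F] (π : F[X]) [Fact (Irreducible π)]
    (u : OPi π → OmegaPi π) : Prop :=
  ∀ t : OPi π, ‖(t : KPi π)‖ ≤ ((Fintype.card F : ℝ) ^ π.natDegree)⁻¹ →
    HasSum (fun n : ℕ => oToOmega π t ^ Fintype.card F ^ (n + 1) /
      polyToOmega π (bracket F (n + 1))) (u t)

/-- The continuous `F`-linear solutions on `O_π` that coincide with `l_1` for
`|t| ≤ q ^ (-δ)`. -/
def logExtensions {F : Type*} [Field F] [Fintype F] (π : F[X]) [Fact (Irreducible π)] :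
    Set (OPi π → OmegaPi π) :=
  {u | Continuous u ∧ IsFqLinear π u ∧ SolvesLogEquation π u ∧ AgreesWithLog π u}

/-- `u = ∑_{i ≥ 0} c_i f_i`, the series converging uniformly on `O_π`. -/
def IsCarlitzExpansion {F : Type*} [Field F] [Fintype F] (π : F[X]) [Fact (Irreducible π)]
    (c : ℕ → OmegaPi π) (u : OPi π → OmegaPi π) : Prop :=
  TendstoUniformly (fun (N : ℕ) (t : OPi π) => ∑ i ∈ Finset.range N, c i * carlitzF π i t) u
    Filter.atTop

/-- The equations for `c_1, …, c_δ`: `c_1 ^ q - c_1 + 1 = 0` and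
`c_{i+1} ^ q - c_{i+1} + [i] ^ q c_i ^ q = 0` for `1 ≤ i ≤ δ - 1`. -/
def HeadRelations {F : Type*} [Field F] [Fintype F] (π : F[X]) [Fact (Irreducible π)]
    (c : ℕ → OmegaPi π) : Prop :=
  c 1 ^ Fintype.card F - c 1 + 1 = 0 ∧
    ∀ i, 1 ≤ i → i < π.natDegree →
      c (i + 1) ^ Fintype.card F - c (i + 1) +
        polyToOmega π (bracket F i) ^ Fintype.card F * c i ^ Fintype.card F = 0

/-- The relations for the higher coefficients:
`c_n = ∑_{j ≥ 0} (c_{n-1} [n-1]) ^ (q ^ (j+1))` for `n ≥ δ + 1`. -/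
def TailRelations {F : Type*} [Field F] [Fintype F] (π : F[X]) [Fact (Irreducible π)]
    (c : ℕ → OmegaPi π) : Prop :=
  ∀ n, π.natDegree + 1 ≤ n →
    HasSum (fun j : ℕ =>
      (c (n - 1) * polyToOmega π (bracket F (n - 1))) ^ Fintype.card F ^ (j + 1)) (c n)

/-- The relation for `c_0`: `c_0 = ∑_{i ≥ 1} (-1) ^ (i+1) c_i / L_i`, summed over `i = k + 1`. -/
def ConstRelation {F : Type*} [Field F] [Fintype F] (π : F[X]) [Fact (Irreducible π)]
    (c : ℕ → OmegaPi π) : Prop :=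
  HasSum (fun k : ℕ => (-1) ^ (k + 1 + 1) * (c (k + 1) / polyToOmega π (carlitzL F (k + 1)))) (c 0)

end CarlitzPlace

end

noncomputable section

namespace CarlitzPlace

/-! ### Additivity of the q-power map and identities for the Carlitz polynomials over any field
containing F[x]. -/

section Algebra

/-! Raising the equation to the power q removes the root: it becomes w - w^q = t^q for w = Δu
(`carlitzD_sub_frobTau_eq_iff`). Two identities make this tractable on Carlitz series: Δf_{i+1} =
f_i^q (`carF_succ_X_mul`) and f_i^q = f_i + [i+1] f_{i+1} (`carF_pow_card`). With them, the single
recursion c_{n+1} - c_{n+1}^q = ([n] c_n)^q for n ≥ 1, together with c_1 - c_1^q = 1, makes w - w^q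
telescope to t^q (`carlitzDelta_carlitzSum_sub_pow`).

The roots of z - z^q = a differ by elements of F. The first δ roots are free. From index δ + 1 on,
|c_n [n]| < 1 and the tail relations select the small root Σ a^(q^j), which gives very fast decay of
the c_n and makes Δu small on πO_π. The logarithm series has Δ equal to the small root as well, so
on πO_π the two Δ agree, and the difference of the two functions is F[x]-linear. Such a function is
determined by its quotients y(t)/t along t → 0; the relation for c_0 says precisely that the Carlitz
series has derivative zero at 0, as the logarithm does, so they coincide
(`carlitzSum_mul_eq_logSum`).

This gives an injection of F^δ into the set of solutions. Conversely, for two solutions the values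
of Δ at 1, x, …, x^(δ-1) differ by elements of F, and these differences from a fixed solution
determine a solution (`exists_injective_from_logExtensions`). The two injections force the count
q^δ, and also show that every solution is one of the constructed series. Thus neither a general
expansion theorem for continuous linear functions nor a derivation of the relations from the
equation is needed. Uniqueness of expansions is triangularity at the powers of x. -/

theorem charP_of_polynomialHom {F : Type*} [Field F] {A : Type*} [CommRing A] [Nontrivial A] (ψ : F[X] →+* A) (p : ℕ)
    [CharP F p] : CharP A p :=
  charP_of_injective_ringHom (f := ψ.comp Polynomial.C) (RingHom.injective _) p

variable {F : Type*} [Field F] [Fintype F]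

theorem add_pow_card_pow {A : Type*} [CommRing A] [Nontrivial A] (ψ : F[X] →+* A) (a b : A)
    (n : ℕ) : (a + b) ^ Fintype.card F ^ n =
      a ^ Fintype.card F ^ n + b ^ Fintype.card F ^ n := by
  obtain ⟨p, hp⟩ := CharP.exists F
  obtain ⟨m, hpp, hm⟩ := FiniteField.card F p
  have : Fact p.Prime := ⟨hpp⟩
  have := charP_of_polynomialHom ψ p
  rw [hm, ← pow_mul]
  exact add_pow_char_pow a b _ _

theorem add_pow_card {A : Type*} [CommRing A] [Nontrivial A] (ψ : F[X] →+* A) (a b : A) :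
    (a + b) ^ Fintype.card F = a ^ Fintype.card F + b ^ Fintype.card F := by
  simpa using add_pow_card_pow ψ a b 1

theorem sub_pow_card {A : Type*} [CommRing A] [Nontrivial A] (ψ : F[X] →+* A) (a b : A) :
    (a - b) ^ Fintype.card F = a ^ Fintype.card F - b ^ Fintype.card F := by
  rw [eq_sub_iff_add_eq, ← add_pow_card ψ, sub_add_cancel]

theorem C_pow_card_pow {A : Type*} [CommRing A] (ψ : F[X] →+* A) (α : F) (n : ℕ) :
    ψ (Polynomial.C α) ^ Fintype.card F ^ n = ψ (Polynomial.C α) := by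
  rw [← map_pow, ← map_pow, FiniteField.pow_card_pow]

theorem C_pow_card {A : Type*} [CommRing A] (ψ : F[X] →+* A) (α : F) :
    ψ (Polynomial.C α) ^ Fintype.card F = ψ (Polynomial.C α) := by
  simpa using C_pow_card_pow ψ α 1

theorem prod_sub_C {A : Type*} [CommRing A] (ψ : F[X] →+* A) (a : A) :
    ∏ α : F, (a - ψ (Polynomial.C α)) = a ^ Fintype.card F - a := by
  have h : ∏ α : F, (Polynomial.X - Polynomial.C α) =
      (Polynomial.X ^ Fintype.card F - Polynomial.X : F[X]) := by
    have hm : (Polynomial.X ^ Fintype.card F - Polynomial.X : F[X]).Monic :=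
      Polynomial.monic_X_pow_sub (by simpa using Fintype.one_lt_card)
    have h1 := Polynomial.prod_multiset_X_sub_C_of_monic_of_roots_card_eq hm (by
      rw [FiniteField.roots_X_pow_card_sub_X,
        FiniteField.X_pow_card_sub_X_natDegree_eq F Fintype.one_lt_card]
      rfl)
    rw [FiniteField.roots_X_pow_card_sub_X] at h1
    exact h1
  have h2 := congrArg (Polynomial.eval₂ (ψ.comp Polynomial.C) a) h
  simpa [Polynomial.eval₂_finsetProd] using h2

theorem exists_C_of_pow_card_eq {A : Type*} [Field A] (ψ : F[X] →+* A) {a : A}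
    (h : a ^ Fintype.card F = a) : ∃ α : F, a = ψ (Polynomial.C α) := by
  have h1 := prod_sub_C ψ a
  rw [h, sub_self, Finset.prod_eq_zero_iff] at h1
  obtain ⟨α, -, hα⟩ := h1
  exact ⟨α, sub_eq_zero.1 hα⟩

theorem prod_sub_C_mul {A : Type*} [Field A] (ψ : F[X] →+* A) (a b : A) :
    ∏ α : F, (a - ψ (Polynomial.C α) * b) =
      a ^ Fintype.card F - b ^ (Fintype.card F - 1) * a := by
  have hq : Fintype.card F - 1 ≠ 0 := by
    have := Fintype.one_lt_card (α := F); omega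
  have hq2 : Fintype.card F = Fintype.card F - 1 + 1 := by omega
  by_cases hb : b = 0
  · subst hb
    simp [hq]
  · have : ∀ α : F, a - ψ (Polynomial.C α) * b = b * (a / b - ψ (Polynomial.C α)) := by
      intro α; field_simp
    simp_rw [this]
    rw [Finset.prod_mul_distrib, prod_sub_C, Finset.prod_const, Finset.card_univ, div_pow]
    set q := Fintype.card F
    rw [mul_sub, mul_div_cancel₀ _ (pow_ne_zero _ hb)]
    congr 1
    nth_rewrite 1 [hq2]
    rw [pow_succ]
    field_simp

/-- The product of `T - ω` over the polynomials `ω` of degree less than `i`, in an `F[x]`-algebra. -/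
def carE {A : Type*} [CommRing A] (ψ : F[X] →+* A) (i : ℕ) (T : A) : A :=
  ∏ ω : Polynomial.degreeLT F i, (T - ψ (ω : F[X]))

theorem carE_zero {A : Type*} [CommRing A] (ψ : F[X] →+* A) (T : A) : carE ψ 0 T = T := by
  have : ∀ ω : Polynomial.degreeLT F 0, (ω : F[X]) = 0 := by
    intro ω
    have := Polynomial.mem_degreeLT.1 ω.2
    simpa using this
  have h2 : (Finset.univ : Finset (Polynomial.degreeLT F 0)) = {0} :=
    Finset.eq_singleton_iff_unique_mem.2
      ⟨Finset.mem_univ _, fun a _ => Subtype.ext (by simp [this])⟩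
  simp [carE, h2]

/-- Splits off the coefficient of x^i; this is what turns the product defining e_{i+1} into a
product over F of translates of e_i. -/
theorem bijective_degreeLT_succ (i : ℕ) :
    Function.Bijective (fun z : F × Polynomial.degreeLT F i =>
      (⟨(z.2 : F[X]) + Polynomial.C z.1 * Polynomial.X ^ i, by
        refine Submodule.add_mem _ (Polynomial.degreeLT_mono (Nat.le_succ i) z.2.2) ?_
        rw [Polynomial.mem_degreeLT]
        refine (Polynomial.degree_C_mul_X_pow_le i z.1).trans_lt ?_
        exact_mod_cast Nat.lt_succ_self i⟩ : Polynomial.degreeLT F (i + 1))) := by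
  rw [Fintype.bijective_iff_injective_and_card]
  constructor
  · rintro ⟨α, ω, hω⟩ ⟨β, η, hη⟩ h
    simp only [Subtype.mk.injEq] at h
    rw [Polynomial.mem_degreeLT] at hω hη
    have h1 := congrArg (fun p => Polynomial.coeff p i) h
    simp only [Polynomial.coeff_add, Polynomial.coeff_C_mul_X_pow, if_true,
      Polynomial.coeff_eq_zero_of_degree_lt hω, Polynomial.coeff_eq_zero_of_degree_lt hη,
      zero_add] at h1
    subst h1
    simpa using h
  · have hc : ∀ j, Fintype.card (Polynomial.degreeLT F j) = Fintype.card F ^ j := by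
      intro j
      rw [Fintype.card_congr (Polynomial.degreeLTEquiv F j).toEquiv]
      simp
    rw [Fintype.card_prod, hc, hc, pow_succ, mul_comm]

theorem carE_succ_eq_prod {A : Type*} [CommRing A] (ψ : F[X] →+* A) (i : ℕ) (T : A) :
    carE ψ (i + 1) T =
      ∏ α : F, carE ψ i (T - ψ (Polynomial.C α) * ψ Polynomial.X ^ i) := by
  rw [carE, ← (bijective_degreeLT_succ (F := F) i).prod_comp, Fintype.prod_prod_type]
  refine Finset.prod_congr rfl fun α _ => Finset.prod_congr rfl fun ω _ => ?_
  simp only [map_add, map_mul, map_pow]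
  ring

theorem carE_of_degree_lt {A : Type*} [CommRing A] (ψ : F[X] →+* A) {i : ℕ} {p : F[X]}
    (hp : p.degree < i) : carE ψ i (ψ p) = 0 :=
  Finset.prod_eq_zero (Finset.mem_univ ⟨p, Polynomial.mem_degreeLT.2 hp⟩) (by simp)

/-- Linearity and the recursion are proved in one induction. If e_i is linear, then e_{i+1}(t) is
the product over α of a - αb with a = e_i(t) and b = e_i(x^i), that is a^q - b^(q-1) a, which is
again linear in t. -/
theorem carE_linear_and_succ {A : Type*} [Field A] (ψ : F[X] →+* A) (i : ℕ) :
    (∀ s t, carE ψ i (s + t) = carE ψ i s + carE ψ i t) ∧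
      (∀ (α : F) t, carE ψ i (ψ (Polynomial.C α) * t) = ψ (Polynomial.C α) * carE ψ i t) ∧
      ∀ t, carE ψ (i + 1) t = carE ψ i t ^ Fintype.card F -
        carE ψ i (ψ Polynomial.X ^ i) ^ (Fintype.card F - 1) * carE ψ i t := by
  have key : ∀ i, (∀ s t, carE ψ i (s + t) = carE ψ i s + carE ψ i t) →
      (∀ (α : F) t, carE ψ i (ψ (Polynomial.C α) * t) = ψ (Polynomial.C α) * carE ψ i t) →
      ∀ t, carE ψ (i + 1) t = carE ψ i t ^ Fintype.card F -
        carE ψ i (ψ Polynomial.X ^ i) ^ (Fintype.card F - 1) * carE ψ i t := by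
    intro i ha hs t
    rw [carE_succ_eq_prod, ← prod_sub_C_mul ψ]
    refine Finset.prod_congr rfl fun α _ => ?_
    rw [eq_sub_iff_add_eq, ← hs, ← ha, sub_add_cancel]
  induction i with
  | zero => 
    have h1 : ∀ s t, carE ψ 0 (s + t) = carE ψ 0 s + carE ψ 0 t := by simp [carE_zero]
    have h2 : ∀ (α : F) t, carE ψ 0 (ψ (Polynomial.C α) * t) =
      ψ (Polynomial.C α) * carE ψ 0 t := by simp [carE_zero]
    exact ⟨h1, h2, key 0 h1 h2⟩
  | succ i ih =>
    obtain ⟨ha, hs, hr⟩ := ih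
    have h1 : ∀ s t, carE ψ (i + 1) (s + t) = carE ψ (i + 1) s + carE ψ (i + 1) t := by
      intro s t
      rw [hr, hr, hr, ha, add_pow_card ψ]
      ring
    have h2 : ∀ (α : F) t, carE ψ (i + 1) (ψ (Polynomial.C α) * t) =
        ψ (Polynomial.C α) * carE ψ (i + 1) t := by
      intro α t
      rw [hr, hr, hs, mul_pow, C_pow_card]
      ring
    exact ⟨h1, h2, key _ h1 h2⟩

theorem carlitzFactorial_succ (n : ℕ) :
    carlitzFactorial F (n + 1) =
      bracket F (n + 1) * carlitzFactorial F n ^ Fintype.card F := by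
  rw [carlitzFactorial, Finset.prod_range_succ', carlitzFactorial, ← Finset.prod_pow]
  simp only [Nat.add_sub_add_right, pow_succ, pow_mul, Nat.sub_zero, pow_zero, pow_one]
  rw [mul_comm]

theorem bracket_ne_zero {n : ℕ} (hn : n ≠ 0) : bracket F n ≠ 0 :=
  FiniteField.X_pow_card_pow_sub_X_ne_zero F hn Fintype.one_lt_card

theorem carlitzFactorial_ne_zero (n : ℕ) : carlitzFactorial F n ≠ 0 := by
  induction n with
  | zero => simp [carlitzFactorial]
  | succ n ih =>
    rw [carlitzFactorial_succ]
    exact mul_ne_zero (bracket_ne_zero n.succ_ne_zero) (pow_ne_zero _ ih)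

theorem carlitzL_ne_zero (n : ℕ) : carlitzL F n ≠ 0 :=
  Finset.prod_ne_zero_iff.2 fun _ _ => bracket_ne_zero (Nat.succ_ne_zero _)

theorem carlitzL_succ (n : ℕ) :
    carlitzL F (n + 1) = carlitzL F n * bracket F (n + 1) :=
  Finset.prod_range_succ _ _

theorem bracket_map {A : Type*} [CommRing A] (ψ : F[X] →+* A) (n : ℕ) :
    ψ (bracket F n) = ψ Polynomial.X ^ Fintype.card F ^ n - ψ Polynomial.X := by
  simp [bracket]

/-- The two halves feed each other. Since e_{i+1}(x^i) = 0, the multiplication formula at t = x^i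
gives e_{i+1}(x^(i+1)) = [i+1] D_i^q = D_{i+1}; knowing these values makes the recursion for e
explicit, which gives the multiplication formula one level up. -/
theorem carE_X_mul_and_value {A : Type*} [Field A] (ψ : F[X] →+* A) (i : ℕ) :
    (∀ t, carE ψ (i + 1) (ψ Polynomial.X * t) = ψ Polynomial.X * carE ψ (i + 1) t +
        ψ (bracket F (i + 1)) * carE ψ i t ^ Fintype.card F) ∧
      carE ψ i (ψ Polynomial.X ^ i) = ψ (carlitzFactorial F i) := by
  have hq2 : Fintype.card F = Fintype.card F - 1 + 1 := by
    have := Fintype.one_lt_card (α := F); omega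
  induction i with
  | zero =>
    refine ⟨fun t => ?_, by simp [carE_zero, carlitzFactorial]⟩
    rw [(carE_linear_and_succ ψ 0).2.2, (carE_linear_and_succ ψ 0).2.2, bracket_map]
    simp only [carE_zero, pow_zero, one_pow, one_mul, mul_pow, zero_add, pow_one]
    ring
  | succ i ih =>
    obtain ⟨hd, hv⟩ := ih
    have hv' : carE ψ (i + 1) (ψ Polynomial.X ^ (i + 1)) = ψ (carlitzFactorial F (i + 1)) := by
      rw [pow_succ', hd, hv, ← map_pow ψ, carE_of_degree_lt, carlitzFactorial_succ]
      · simp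
      · rw [Polynomial.degree_X_pow]
        exact_mod_cast Nat.lt_succ_self i
    refine ⟨fun t => ?_, hv'⟩
    have hr := (carE_linear_and_succ ψ (i + 1)).2.2
    have hr' := (carE_linear_and_succ ψ i).2.2 t
    rw [hv'] at hr
    rw [hv] at hr'
    -- Both sides come from D_{i+1} = [i+1] D_i^q.
    have hD : ψ (carlitzFactorial F (i + 1)) ^ (Fintype.card F - 1) * ψ (bracket F (i + 1)) =
        ψ (bracket F (i + 1)) ^ Fintype.card F *
          (ψ (carlitzFactorial F i) ^ (Fintype.card F - 1)) ^ Fintype.card F := by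
      rw [carlitzFactorial_succ, map_mul, map_pow, mul_pow, ← pow_mul, ← pow_mul,
        mul_comm (Fintype.card F) (Fintype.card F - 1)]
      have h3 : ψ (bracket F (i + 1)) ^ Fintype.card F =
          ψ (bracket F (i + 1)) ^ (Fintype.card F - 1) * ψ (bracket F (i + 1)) := by
        rw [← pow_succ, ← hq2]
      rw [h3]
      ring
    have hsq : carE ψ (i + 1) t ^ Fintype.card F =
        (carE ψ i t ^ Fintype.card F) ^ Fintype.card F -
          (ψ (carlitzFactorial F i) ^ (Fintype.card F - 1)) ^ Fintype.card F *
            carE ψ i t ^ Fintype.card F := by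
      rw [hr', sub_pow_card ψ, mul_pow]
    have hb : ψ (bracket F (i + 1 + 1)) = ψ (bracket F (i + 1)) ^ Fintype.card F +
        (ψ Polynomial.X ^ Fintype.card F - ψ Polynomial.X) := by
      rw [bracket_map, bracket_map, sub_pow_card ψ, ← pow_mul, ← pow_succ]
      ring
    rw [hr, hr, hd, add_pow_card ψ, mul_pow, mul_pow, hb]
    linear_combination (-carE ψ i t ^ Fintype.card F) * hD -
      ψ (bracket F (i + 1)) ^ Fintype.card F * hsq

/-- The normalized Carlitz polynomials in an `F[x]`-field. -/
def carF {A : Type*} [Field A] (ψ : F[X] →+* A) (i : ℕ) (T : A) : A :=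
  carE ψ i T / ψ (carlitzFactorial F i)

section

variable {A : Type*} [Field A] (ψ : F[X] →+* A)

theorem carF_add (i : ℕ) (s t : A) : carF ψ i (s + t) = carF ψ i s + carF ψ i t := by
  rw [carF, (carE_linear_and_succ ψ i).1, add_div]; rfl

theorem carF_C_mul (i : ℕ) (α : F) (t : A) :
    carF ψ i (ψ (Polynomial.C α) * t) = ψ (Polynomial.C α) * carF ψ i t := by
  rw [carF, (carE_linear_and_succ ψ i).2.1, mul_div_assoc]; rfl

theorem carF_zero (t : A) : carF ψ 0 t = t := by
  simp [carF, carE_zero, carlitzFactorial]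

theorem carF_of_degree_lt {i : ℕ} {p : F[X]} (hp : p.degree < i) : carF ψ i (ψ p) = 0 := by
  rw [carF, carE_of_degree_lt ψ hp, zero_div]

theorem carF_X_pow (hψ : Function.Injective ψ) (i : ℕ) : carF ψ i (ψ Polynomial.X ^ i) = 1 := by
  rw [carF, (carE_X_mul_and_value ψ i).2, div_self]
  exact (map_ne_zero_iff ψ hψ).2 (carlitzFactorial_ne_zero i)

/-- In other words Δf_{i+1} = f_i^q, so Δ shifts the coefficients of a Carlitz series by one. -/
theorem carF_succ_X_mul (hψ : Function.Injective ψ) (i : ℕ) (t : A) :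
    carF ψ (i + 1) (ψ Polynomial.X * t) =
      ψ Polynomial.X * carF ψ (i + 1) t + carF ψ i t ^ Fintype.card F := by
  have hb : ψ (bracket F (i + 1)) ≠ 0 := (map_ne_zero_iff ψ hψ).2 (bracket_ne_zero i.succ_ne_zero)
  have hD : ψ (carlitzFactorial F i) ≠ 0 :=
    (map_ne_zero_iff ψ hψ).2 (carlitzFactorial_ne_zero i)
  rw [carF, carF, carF, (carE_X_mul_and_value ψ i).1, carlitzFactorial_succ, map_mul, map_pow,
    div_pow]
  field_simp

/-- The recursion e_{i+1} = e_i^q - D_i^(q-1) e_i divided by D_i^q. It is behind the telescoping,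
the bound by 1/|L_i| and the derivative of f_i at 0. -/
theorem carF_pow_card (hψ : Function.Injective ψ) (i : ℕ) (t : A) :
    carF ψ i t ^ Fintype.card F =
      carF ψ i t + ψ (bracket F (i + 1)) * carF ψ (i + 1) t := by
  have hq2 : Fintype.card F = Fintype.card F - 1 + 1 := by
    have := Fintype.one_lt_card (α := F); omega
  have hb : ψ (bracket F (i + 1)) ≠ 0 := (map_ne_zero_iff ψ hψ).2 (bracket_ne_zero i.succ_ne_zero)
  have hD : ψ (carlitzFactorial F i) ≠ 0 :=
    (map_ne_zero_iff ψ hψ).2 (carlitzFactorial_ne_zero i)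
  rw [carF, carF, (carE_linear_and_succ ψ i).2.2, (carE_X_mul_and_value ψ i).2,
    carlitzFactorial_succ, map_mul, map_pow, div_pow]
  have h3 : ψ (carlitzFactorial F i) ^ Fintype.card F =
      ψ (carlitzFactorial F i) ^ (Fintype.card F - 1) * ψ (carlitzFactorial F i) := by
    rw [← pow_succ, ← hq2]
  rw [h3]
  field_simp
  ring

end

end Algebra

/-! ### Absolute values of [n] and L_n, and polynomial approximation in O_π. -/

section Norms

variable {F : Type*} [Field F] [Fintype F] (π : F[X])

/-- The absolute value `q ^ (-δ)` of the uniformizer `π`. -/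
def rho : ℝ := ((Fintype.card F : ℝ) ^ π.natDegree)⁻¹

theorem rho_pos : 0 < rho π := by
  have : (0 : ℝ) < Fintype.card F := by exact_mod_cast Fintype.card_pos
  unfold rho; positivity

variable [Fact (Irreducible π)]

theorem rho_lt_one : rho π < 1 :=
  inv_lt_one_of_one_lt₀ (by exact_mod_cast one_lt_base π)

theorem norm_polyToOmega (f : F[X]) : ‖polyToOmega π f‖ = ‖polyToK π f‖ :=
  norm_kToOmega π _

theorem norm_polyToOmega_le_one (f : F[X]) : ‖polyToOmega π f‖ ≤ 1 :=
  (norm_polyToOmega π f).trans_le (norm_polyToK_le_one π f)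

theorem norm_polyToOmega_self : ‖polyToOmega π π‖ = rho π :=
  (norm_polyToOmega π π).trans (norm_polyToK_self π)

theorem norm_polyToK_eq_one {f : F[X]} (h : ¬ π ∣ f) : ‖polyToK π f‖ = 1 := by
  rw [polyToK, RingHom.comp_apply, norm_ratToK]
  refine ((place π).adicAbv_coe_eq_one_iff (one_lt_base π) f).2 fun hm => h ?_
  exact Ideal.mem_span_singleton.1 hm

theorem polyToOmega_injective : Function.Injective (polyToOmega π) := by
  rw [polyToOmega, polyToK]
  exact (kToOmega π).injective.comp
    ((ratToK π).injective.comp (RatFunc.algebraMap_injective F))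

theorem polyToK_injective : Function.Injective (polyToK π) := by
  rw [polyToK]
  exact (ratToK π).injective.comp (RatFunc.algebraMap_injective F)

/-- The derivative of [n] is -1, so [n] is squarefree and π divides it at most once. -/
theorem rho_le_norm_bracket {n : ℕ} (hn : n ≠ 0) :
    rho π ≤ ‖polyToOmega π (bracket F n)‖ := by
  by_cases h : π ∣ bracket F n
  · obtain ⟨g, hg⟩ := h
    have h2 : ¬ π ∣ g := by
      rintro ⟨k, rfl⟩
      have hd := congrArg Polynomial.derivative hg
      have h0 : ((Fintype.card F ^ n : ℕ) : F) = 0 := by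
        rw [Nat.cast_pow, FiniteField.cast_card_eq_zero, zero_pow hn]
      rw [bracket, Polynomial.derivative_sub, Polynomial.derivative_X_pow,
        Polynomial.derivative_X] at hd
      rw [h0, map_zero, zero_mul, zero_sub, Polynomial.derivative_mul, Polynomial.derivative_mul] at hd
      have : π ∣ 1 := by
        refine (dvd_neg (b := (1 : F[X]))).1 ?_
        rw [hd]
        exact ⟨Polynomial.derivative π * k + (Polynomial.derivative π * k +
          π * Polynomial.derivative k), by ring⟩
      exact (Fact.out : Irreducible π).not_isUnit (isUnit_of_dvd_one this)
    rw [hg, map_mul, norm_mul, norm_polyToOmega_self, norm_polyToOmega, norm_polyToK_eq_one π h2,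
      mul_one]
  · rw [norm_polyToOmega, norm_polyToK_eq_one π h]
    exact (rho_lt_one π).le

theorem norm_bracket_eq_one {n : ℕ} (hn : n ≠ 0) (h : n < π.natDegree) :
    ‖polyToOmega π (bracket F n)‖ = 1 := by
  rw [norm_polyToOmega, norm_polyToK_eq_one]
  intro hd
  have h1 : Irreducible π := Fact.out
  have h2 := h1.natDegree_dvd_of_dvd_X_pow_card_pow_sub_X (n := n)
    (by rw [Nat.card_eq_fintype_card]; exact hd)
  exact absurd (Nat.le_of_dvd (Nat.pos_of_ne_zero hn) h2) (not_le.2 h)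

theorem norm_bracket_natDegree_le :
    ‖polyToOmega π (bracket F π.natDegree)‖ ≤ rho π := by
  have h1 : Irreducible π := Fact.out
  have h2 := (h1.natDegree_dvd_iff_dvd_X_pow_card_pow_sub_X (n := π.natDegree)).1 dvd_rfl
  rw [Nat.card_eq_fintype_card] at h2
  obtain ⟨g, hg⟩ := h2
  rw [bracket, hg, map_mul, norm_mul, norm_polyToOmega_self]
  exact mul_le_of_le_one_right (rho_pos π).le (norm_polyToOmega_le_one π g)

theorem rho_pow_le_norm_carlitzL (n : ℕ) : rho π ^ n ≤ ‖polyToOmega π (carlitzL F n)‖ := by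
  induction n with
  | zero => simp [carlitzL]
  | succ n ih =>
    rw [carlitzL_succ, map_mul, norm_mul, pow_succ]
    exact mul_le_mul ih (rho_le_norm_bracket π n.succ_ne_zero) (rho_pos π).le (norm_nonneg _)

theorem norm_carlitzL_eq_one {n : ℕ} (h : n < π.natDegree) :
    ‖polyToOmega π (carlitzL F n)‖ = 1 := by
  induction n with
  | zero => simp [carlitzL]
  | succ n ih =>
    rw [carlitzL_succ, map_mul, norm_mul, ih (by omega), norm_bracket_eq_one π n.succ_ne_zero h,
      one_mul]

/-- The residue field of O_π is F[x]/(π): a nearby rational function is integral, so its reduced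
denominator is prime to π and can be inverted modulo π. -/
theorem exists_norm_sub_polyToK_le {t : KPi π} (ht : ‖t‖ ≤ 1) :
    ∃ p : F[X], ‖t - polyToK π p‖ ≤ rho π := by
  obtain ⟨w, hw⟩ : ∃ w : RatFunc F, dist t (ratToK π w) < rho π := by
    obtain ⟨y, hy⟩ := UniformSpace.Completion.denseRange_coe.exists_dist_lt t (rho_pos π)
    exact ⟨y.ofAbs, hy⟩
  rw [dist_eq_norm] at hw
  have hπ : Irreducible π := Fact.out
  have hw1 : ‖ratToK π w‖ ≤ 1 := by
    have := IsUltrametricDist.norm_add_le_max t (-(t - ratToK π w))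
    rw [norm_neg, ← sub_eq_add_neg, sub_sub_cancel] at this
    exact this.trans (max_le ht (hw.le.trans (rho_lt_one π).le))
  have hwq : ratToK π w = polyToK π w.num / polyToK π w.denom := by
    nth_rewrite 1 [← RatFunc.num_div_denom w]
    rw [map_div₀]; rfl
  have hden : ¬ π ∣ w.denom := by
    intro hd
    have hnum : ¬ π ∣ w.num := fun hn =>
      hπ.not_isUnit ((RatFunc.isCoprime_num_denom w).isUnit_of_dvd' hn hd)
    obtain ⟨g, hg⟩ := hd
    have hlt : ‖polyToK π w.denom‖ < 1 := by
      rw [hg, map_mul, norm_mul, norm_polyToK_self]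
      exact (mul_le_of_le_one_right (rho_pos π).le (norm_polyToK_le_one π g)).trans_lt
        (rho_lt_one π)
    have hpos : 0 < ‖polyToK π w.denom‖ :=
      norm_pos_iff.2 ((map_ne_zero_iff _ (polyToK_injective π)).2 w.denom_ne_zero)
    rw [hwq, norm_div, norm_polyToK_eq_one π hnum, div_le_one hpos] at hw1
    exact absurd hw1 (not_le.2 hlt)
  -- Here a * denom + b * π = 1, so num * a represents num / denom modulo π.
  obtain ⟨a, b, hab⟩ := (hπ.coprime_iff_not_dvd.2 hden).symm
  have hd0 : polyToK π w.denom ≠ 0 :=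
    (map_ne_zero_iff _ (polyToK_injective π)).2 w.denom_ne_zero
  refine ⟨w.num * a, ?_⟩
  have hdiff : ratToK π w - polyToK π (w.num * a) =
      polyToK π (w.num * b) * polyToK π π / polyToK π w.denom := by
    have h1 := congrArg (polyToK π) hab
    simp only [map_add, map_mul, map_one] at h1 ⊢
    rw [hwq]
    field_simp
    linear_combination (-polyToK π w.num) * h1
  have h2 : ‖ratToK π w - polyToK π (w.num * a)‖ ≤ rho π := by
    rw [hdiff, norm_div, norm_polyToK_eq_one π hden, div_one, norm_mul, norm_polyToK_self]
    exact mul_le_of_le_one_left (rho_pos π).le (norm_polyToK_le_one π _)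
  rw [← sub_add_sub_cancel t (ratToK π w)]
  exact (IsUltrametricDist.norm_add_le_max _ _).trans (max_le hw.le h2)

theorem exists_eq_polyToO_add_pow_mul (t : OPi π) (N : ℕ) :
    ∃ (p : F[X]) (s : OPi π), t = polyToO π p + polyToO π π ^ N * s := by
  induction N generalizing t with
  | zero => exact ⟨0, t, by simp⟩
  | succ N ih =>
    obtain ⟨p, hp⟩ := exists_norm_sub_polyToK_le π t.2
    have h0 : polyToK π π ≠ 0 :=
      (map_ne_zero_iff _ (polyToK_injective π)).2 (Fact.out : Irreducible π).ne_zero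
    let s : OPi π := ⟨((t : KPi π) - polyToK π p) / polyToK π π, by
      change ‖_‖ ≤ 1
      rw [norm_div, norm_polyToK_self]
      exact (div_le_one (rho_pos π)).2 hp⟩
    have hs : t = polyToO π p + polyToO π π * s := by
      refine Subtype.ext ?_
      change (t : KPi π) = polyToK π p + polyToK π π * (((t : KPi π) - polyToK π p) / polyToK π π)
      field_simp
      ring
    obtain ⟨p', s', hs'⟩ := ih s
    refine ⟨p + π * p', s', ?_⟩
    rw [hs, hs', map_add, map_mul]
    ring

instance instUltrametricOmegaPi : IsUltrametricDist (OmegaPi π) :=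
  IsUltrametricDist.of_normedAlgebra (KPi π)

theorem polyToOmega_eq (p : F[X]) : polyToOmega π p = oToOmega π (polyToO π p) := rfl

theorem norm_oToOmega (t : OPi π) : ‖oToOmega π t‖ = ‖(t : KPi π)‖ := norm_kToOmega π _

theorem norm_oToOmega_le_one (t : OPi π) : ‖oToOmega π t‖ ≤ 1 :=
  (norm_oToOmega π t).trans_le t.2

theorem oToOmega_injective : Function.Injective (oToOmega π) :=
  (kToOmega π).injective.comp Subtype.val_injective

theorem continuous_oToOmega : Continuous (oToOmega π) := by
  have : Isometry (kToOmega π) :=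
    AddMonoidHomClass.isometry_of_norm (kToOmega π) (norm_kToOmega π)
  exact this.continuous.comp continuous_subtype_val

theorem carlitzF_eq (i : ℕ) (t : OPi π) :
    carlitzF π i t = carF (polyToOmega π) i (oToOmega π t) := by
  rw [carlitzF, carF, carE, carlitzE, map_div₀, map_prod]
  simp only [map_sub]
  rfl

end Norms

/-! ### Ultrametric series and the equation z - z^q = a. -/

section ArtinSchreier

theorem norm_le_of_hasSum {E : Type*} [NormedAddCommGroup E] [IsUltrametricDist E]
    {f : ℕ → E} {a : E} (h : HasSum f a) {C : ℝ} (hC : ∀ n, ‖f n‖ ≤ C) : ‖a‖ ≤ C := by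
  have h0 : 0 ≤ C := (norm_nonneg _).trans (hC 0)
  refine le_of_tendsto h.norm (Filter.Eventually.of_forall fun s => ?_)
  exact IsUltrametricDist.norm_sum_le_of_forall_le_of_nonneg h0 fun i _ => hC i

theorem tendsto_pow_pow_zero {q : ℕ} (hq : 1 < q) {r : ℝ} (h0 : 0 ≤ r) (h1 : r < 1) :
    Filter.Tendsto (fun j : ℕ => r ^ q ^ j) Filter.atTop (𝓝 0) :=
  (tendsto_pow_atTop_nhds_zero_of_lt_one h0 h1).comp (tendsto_pow_atTop_atTop_of_one_lt hq)

variable {F : Type*} [Field F] [Fintype F]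

theorem summable_of_tendsto_zero {E : Type*} [NormedAddCommGroup E] [IsUltrametricDist E]
    [CompleteSpace E] {f : ℕ → E} (h : Filter.Tendsto f Filter.atTop (𝓝 0)) : Summable f :=
  NonarchimedeanAddGroup.summable_of_tendsto_cofinite_zero (by rwa [Nat.cofinite_eq_atTop])

/-- Taking `q`-th powers as an additive map. -/
def frobHom {A : Type*} [CommRing A] [Nontrivial A] (ψ : F[X] →+* A) : A →+ A where
  toFun a := a ^ Fintype.card F
  map_zero' := zero_pow Fintype.card_ne_zero
  map_add' := add_pow_card ψ

theorem hasSum_pow_card {A : Type*} [NormedField A] (ψ : F[X] →+* A) {f : ℕ → A} {a : A}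
    (h : HasSum f a) : HasSum (fun n => f n ^ Fintype.card F) (a ^ Fintype.card F) :=
  h.map (frobHom ψ) (continuous_pow _)

theorem summable_pow_card_pow {A : Type*} [NormedField A] [IsUltrametricDist A] [CompleteSpace A]
    {a : A} (ha : ‖a‖ < 1) : Summable fun j : ℕ => a ^ Fintype.card F ^ j := by
  refine summable_of_tendsto_zero (tendsto_zero_iff_norm_tendsto_zero.2 ?_)
  simpa only [norm_pow] using tendsto_pow_pow_zero Fintype.one_lt_card (norm_nonneg a) ha

theorem hasSum_pow_card_pow_sub {A : Type*} [NormedField A] (ψ : F[X] →+* A) {a s : A}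
    (hs : HasSum (fun j : ℕ => a ^ Fintype.card F ^ j) s) : s - s ^ Fintype.card F = a := by
  have h1 := hasSum_pow_card ψ hs
  have h2 := (hasSum_nat_add_iff' 1).2 hs
  simp only [← pow_mul, ← pow_succ] at h1
  have h3 := h1.unique h2
  simp at h3
  rw [h3]; ring

/-- The map z ↦ z - z^q is additive, so a may be split as b + (a - b) with b algebraic over K_π and
|a - b| < 1. The algebraic closure handles b, the convergent series Σ (a - b)^(q^j) the rest. -/
theorem exists_sub_pow_card_eq (π : F[X]) [Fact (Irreducible π)] (a : OmegaPi π) :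
    ∃ z : OmegaPi π, z - z ^ Fintype.card F = a := by
  obtain ⟨b, hb⟩ := UniformSpace.Completion.denseRange_coe.exists_dist_lt a one_pos
  rw [dist_eq_norm] at hb
  obtain ⟨s, hs⟩ := summable_pow_card_pow (F := F) hb
  obtain ⟨y, hy⟩ : ∃ y : KPiAlg π, y - y ^ Fintype.card F = b := by
    have hdeg : (Polynomial.X ^ Fintype.card F - (Polynomial.X - Polynomial.C b) :
        Polynomial (KPiAlg π)).degree ≠ 0 := by
      rw [Polynomial.degree_sub_eq_left_of_degree_lt]
      · rw [Polynomial.degree_X_pow]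
        exact_mod_cast Fintype.card_ne_zero
      · rw [Polynomial.degree_X_sub_C, Polynomial.degree_X_pow]
        exact_mod_cast Fintype.one_lt_card
    obtain ⟨y, hy⟩ := IsAlgClosed.exists_root _ hdeg
    refine ⟨y, ?_⟩
    simp only [Polynomial.IsRoot, Polynomial.eval_sub, Polynomial.eval_pow, Polynomial.eval_X,
      Polynomial.eval_C] at hy
    linear_combination -hy
  refine ⟨UniformSpace.Completion.coeRingHom y + s, ?_⟩
  have h1 := hasSum_pow_card_pow_sub (polyToOmega π) hs
  have h2 := congrArg (UniformSpace.Completion.coeRingHom (α := KPiAlg π)) hy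
  rw [map_sub, map_pow] at h2
  have h3 : (UniformSpace.Completion.coeRingHom (α := KPiAlg π)) b = (b : OmegaPi π) := rfl
  rw [h3] at h2
  rw [add_pow_card (polyToOmega π)]
  linear_combination h1 + h2

end ArtinSchreier

/-! ### Size of the normalized Carlitz polynomials on O_π and their behaviour at the origin. -/

section CarlitzBounds

variable {F : Type*} [Field F] [Fintype F] (π : F[X]) [Fact (Irreducible π)]

theorem norm_carF_X_pow_le_one (i k : ℕ) :
    ‖carF (polyToOmega π) i (polyToOmega π Polynomial.X ^ k)‖ ≤ 1 := by
  have hX := norm_polyToOmega_le_one π Polynomial.X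
  induction k generalizing i with
  | zero =>
    cases i with
    | zero => simp [carF_zero]
    | succ i =>
      rw [pow_zero, ← map_one (polyToOmega π), carF_of_degree_lt]
      · simp
      · rw [Polynomial.degree_one]
        exact_mod_cast i.succ_pos
  | succ k ih =>
    cases i with
    | zero =>
      rw [carF_zero, norm_pow]
      exact pow_le_one₀ (norm_nonneg _) hX
    | succ i =>
      rw [pow_succ', carF_succ_X_mul _ (polyToOmega_injective π)]
      refine (IsUltrametricDist.norm_add_le_max _ _).trans (max_le ?_ ?_)
      · rw [norm_mul]
        exact mul_le_one₀ hX (norm_nonneg _) (ih _)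
      · rw [norm_pow]
        exact pow_le_one₀ (norm_nonneg _) (ih _)

theorem norm_carF_polyToOmega_le_one (i : ℕ) (p : F[X]) :
    ‖carF (polyToOmega π) i (polyToOmega π p)‖ ≤ 1 := by
  induction p using Polynomial.induction_on' with
  | add p q hp hq =>
    rw [map_add, carF_add]
    exact (IsUltrametricDist.norm_add_le_max _ _).trans (max_le hp hq)
  | monomial n a =>
    rw [← Polynomial.C_mul_X_pow_eq_monomial, map_mul, map_pow, carF_C_mul, norm_mul]
    exact mul_le_one₀ (norm_polyToOmega_le_one π _) (norm_nonneg _) (norm_carF_X_pow_le_one π i n)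

theorem denseRange_polyToO : DenseRange (polyToO π) := by
  intro t
  rw [Metric.mem_closure_range_iff]
  intro ε hε
  obtain ⟨N, hN⟩ := exists_pow_lt_of_lt_one hε (rho_lt_one π)
  obtain ⟨p, s, h⟩ := exists_eq_polyToO_add_pow_mul π t N
  refine ⟨p, lt_of_le_of_lt ?_ hN⟩
  have h1 : (t : KPi π) = polyToK π p + polyToK π π ^ N * s := congrArg Subtype.val h
  rw [Subtype.dist_eq, dist_eq_norm]
  change ‖(t : KPi π) - polyToK π p‖ ≤ _
  rw [h1, add_sub_cancel_left, norm_mul, norm_pow, norm_polyToK_self]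
  exact mul_le_of_le_one_right (pow_nonneg (rho_pos π).le _) s.2

theorem continuous_carF {A : Type*} [NormedField A] (ψ : F[X] →+* A) (i : ℕ) :
    Continuous (carF ψ i) := by
  unfold carF carE
  fun_prop

theorem norm_carF_le_one (i : ℕ) (t : OPi π) :
    ‖carF (polyToOmega π) i (oToOmega π t)‖ ≤ 1 := by
  refine (denseRange_polyToO π).induction_on t ?_ fun p => norm_carF_polyToOmega_le_one π i p
  exact isClosed_le ((continuous_carF _ i).comp (continuous_oToOmega π)).norm continuous_const

/-- By induction from f_{i+1} = (f_i^q - f_i)/[i+1], where |f_i^q| ≤ |f_i| because |f_i| ≤ 1 on O_π.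
-/
theorem norm_carF_le_div (i : ℕ) (t : OPi π) :
    ‖carF (polyToOmega π) i (oToOmega π t)‖ ≤
      ‖oToOmega π t‖ / ‖polyToOmega π (carlitzL F i)‖ := by
  induction i with
  | zero => simp [carF_zero, carlitzL]
  | succ i ih =>
    have hb : polyToOmega π (bracket F (i + 1)) ≠ 0 :=
      (map_ne_zero_iff _ (polyToOmega_injective π)).2 (bracket_ne_zero i.succ_ne_zero)
    have h1 := carF_pow_card (polyToOmega π) (polyToOmega_injective π) i (oToOmega π t)
    set f := carF (polyToOmega π) i (oToOmega π t)
    have h2 : carF (polyToOmega π) (i + 1) (oToOmega π t) =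
        (f ^ Fintype.card F + -f) / polyToOmega π (bracket F (i + 1)) := by
      rw [h1]; field_simp; ring
    rw [h2, norm_div, carlitzL_succ, map_mul, norm_mul, ← div_div]
    gcongr
    refine (IsUltrametricDist.norm_add_le_max _ _).trans (max_le ?_ (by rwa [norm_neg]))
    rw [norm_pow]
    exact (pow_le_of_le_one (norm_nonneg _) (norm_carF_le_one π i t)
      Fintype.card_ne_zero).trans ih

/-- The derivative of `f_i` at the origin is `(-1) ^ i / L_i`. -/
theorem tendsto_carF_div {s : ℕ → OPi π} (hs0 : ∀ n, oToOmega π (s n) ≠ 0)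
    (hs : Filter.Tendsto (fun n => oToOmega π (s n)) Filter.atTop (𝓝 0)) (i : ℕ) :
    Filter.Tendsto (fun n => carF (polyToOmega π) i (oToOmega π (s n)) / oToOmega π (s n))
      Filter.atTop (𝓝 ((-1) ^ i / polyToOmega π (carlitzL F i))) := by
  induction i with
  | zero =>
    simp only [carF_zero, pow_zero, div_self (hs0 _)]
    simp [carlitzL]
  | succ i ih =>
    have hb : polyToOmega π (bracket F (i + 1)) ≠ 0 :=
      (map_ne_zero_iff _ (polyToOmega_injective π)).2 (bracket_ne_zero i.succ_ne_zero)
    have hq : Fintype.card F - 1 ≠ 0 := by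
      have := Fintype.one_lt_card (α := F); omega
    have hq2 : Fintype.card F = Fintype.card F - 1 + 1 := by omega
    have h0 : Filter.Tendsto (fun n => carF (polyToOmega π) i (oToOmega π (s n)))
        Filter.atTop (𝓝 0) := by
      have h1 := ih.mul hs
      rw [mul_zero] at h1
      refine h1.congr fun n => ?_
      exact div_mul_cancel₀ _ (hs0 n)
    -- Dividing f_{i+1} = (f_i^q - f_i)/[i+1] by t, the part f_i^q/t = (f_i/t) f_i^(q-1) tends to 0
    -- and only -f_i/(t [i+1]) contributes.
    have h2 := (((ih.mul (h0.pow (Fintype.card F - 1))).sub ih).div_const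
      (polyToOmega π (bracket F (i + 1))))
    rw [zero_pow hq, mul_zero, zero_sub] at h2
    have h3 : -((-1) ^ i / polyToOmega π (carlitzL F i)) / polyToOmega π (bracket F (i + 1)) =
        (-1) ^ (i + 1) / polyToOmega π (carlitzL F (i + 1)) := by
      rw [carlitzL_succ, map_mul, pow_succ, ← div_div]
      ring
    rw [h3] at h2
    refine h2.congr fun n => ?_
    have h4 := carF_pow_card (polyToOmega π) (polyToOmega_injective π) i (oToOmega π (s n))
    rw [hq2, pow_succ] at h4
    have h5 := hs0 n
    field_simp
    linear_combination h4

end CarlitzBounds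

/-! ### Decay of the coefficients, and existence and uniqueness of the sequence. -/

section Relations

theorem natDegree_pos {F : Type*} [Field F] (π : F[X]) [Fact (Irreducible π)] :
    0 < π.natDegree :=
  (Fact.out : Irreducible π).natDegree_pos

variable {F : Type*} [Field F] [Fintype F] {π : F[X]} [Fact (Irreducible π)]

theorem norm_le_one_of_sub_pow {A : Type*} [NormedField A] [IsUltrametricDist A] {q : ℕ}
    (hq : 1 < q) {z : A} (h : ‖z - z ^ q‖ ≤ 1) : ‖z‖ ≤ 1 := by
  by_contra! hz
  have h1 : ‖z‖ < ‖z ^ q‖ := by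
    rw [norm_pow]
    exact lt_self_pow₀ hz hq
  have h2 : ‖z ^ q‖ ≤ max ‖z‖ ‖z - z ^ q‖ := by
    have := IsUltrametricDist.norm_add_le_max z (-(z - z ^ q))
    rwa [norm_neg, ← sub_eq_add_neg, sub_sub_cancel] at this
  rcases le_max_iff.1 h2 with h3 | h3 <;> linarith

theorem HeadRelations.norm_le_one {c : ℕ → OmegaPi π} (h : HeadRelations π c) {i : ℕ}
    (hi : i < π.natDegree) : ‖c (i + 1)‖ ≤ 1 := by
  induction i with
  | zero =>
    refine norm_le_one_of_sub_pow (q := Fintype.card F) Fintype.one_lt_card (le_of_eq ?_)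
    rw [show c (0 + 1) - c (0 + 1) ^ Fintype.card F = 1 by linear_combination -h.1, norm_one]
  | succ i ih =>
    refine norm_le_one_of_sub_pow (q := Fintype.card F) Fintype.one_lt_card ?_
    rw [show c (i + 1 + 1) - c (i + 1 + 1) ^ Fintype.card F =
      polyToOmega π (bracket F (i + 1)) ^ Fintype.card F * c (i + 1) ^ Fintype.card F by
        linear_combination -h.2 (i + 1) (by omega) hi, norm_mul, norm_pow, norm_pow]
    exact mul_le_one₀ (pow_le_one₀ (norm_nonneg _) (norm_polyToOmega_le_one π _))
      (by positivity) (pow_le_one₀ (norm_nonneg _) (ih (by omega)))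

theorem HeadRelations.norm_natDegree_le_one {c : ℕ → OmegaPi π} (h : HeadRelations π c) :
    ‖c π.natDegree‖ ≤ 1 := by
  have h1 := natDegree_pos π
  have h2 := h.norm_le_one (i := π.natDegree - 1) (by omega)
  rwa [Nat.sub_add_cancel h1] at h2

theorem norm_le_pow_card_of_hasSum {A : Type*} [NormedField A] [IsUltrametricDist A] {a s : A}
    (ha : ‖a‖ ≤ 1) (h : HasSum (fun j : ℕ => a ^ Fintype.card F ^ (j + 1)) s) :
    ‖s‖ ≤ ‖a‖ ^ Fintype.card F := by
  refine norm_le_of_hasSum h fun j => ?_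
  rw [norm_pow, pow_succ', pow_mul]
  exact pow_le_of_le_one (by positivity) (pow_le_one₀ (norm_nonneg _) ha)
    (pow_ne_zero _ Fintype.card_ne_zero)

/-- The start is |c_δ [δ]| ≤ |[δ]| ≤ q^(-δ), since π divides [δ]; each tail relation raises the
bound to the power q. Only the relations up to δ + m are assumed, so that the bound is available
while the sequence is still being constructed. -/
theorem norm_mul_bracket_le {c : ℕ → OmegaPi π} (h1 : ‖c π.natDegree‖ ≤ 1) {m : ℕ}
    (h : ∀ n, π.natDegree + 1 ≤ n → n ≤ π.natDegree + m →
      HasSum (fun j : ℕ => (c (n - 1) * polyToOmega π (bracket F (n - 1))) ^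
        Fintype.card F ^ (j + 1)) (c n)) :
    ‖c (π.natDegree + m) * polyToOmega π (bracket F (π.natDegree + m))‖ ≤
      rho π ^ Fintype.card F ^ m ∧
      (m ≠ 0 → ‖c (π.natDegree + m)‖ ≤ rho π ^ Fintype.card F ^ m) := by
  induction m with
  | zero =>
    refine ⟨?_, fun h => absurd rfl h⟩
    rw [add_zero, norm_mul, pow_zero, pow_one]
    exact (mul_le_of_le_one_left (norm_nonneg _) h1).trans (norm_bracket_natDegree_le π)
  | succ m ih =>
    have h2 := (ih fun n hn hn' => h n hn (by omega)).1
    have h3 := h (π.natDegree + m + 1) (by omega) (by omega)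
    rw [Nat.add_sub_cancel] at h3
    have h4 : ‖c (π.natDegree + m + 1)‖ ≤ rho π ^ Fintype.card F ^ (m + 1) := by
      refine (norm_le_pow_card_of_hasSum
        (h2.trans (pow_le_one₀ (rho_pos π).le (rho_lt_one π).le)) h3).trans ?_
      rw [pow_succ (Fintype.card F), pow_mul]
      gcongr
    refine ⟨?_, fun _ => h4⟩
    rw [norm_mul]
    exact (mul_le_of_le_one_right (norm_nonneg _) (norm_polyToOmega_le_one π _)).trans h4

theorem TailRelations.norm_le {c : ℕ → OmegaPi π} (h : TailRelations π c)
    (h1 : ‖c π.natDegree‖ ≤ 1) (m : ℕ) :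
    ‖c (π.natDegree + m + 1)‖ ≤ rho π ^ Fintype.card F ^ (m + 1) :=
  (norm_mul_bracket_le h1 (m := m + 1) fun n hn _ => h n hn).2 m.succ_ne_zero

theorem TailRelations.tendsto_div {c : ℕ → OmegaPi π} (h : TailRelations π c)
    (h1 : ‖c π.natDegree‖ ≤ 1) :
    Filter.Tendsto (fun k => c (k + 1) / polyToOmega π (carlitzL F (k + 1)))
      Filter.atTop (𝓝 0) := by
  rw [← Filter.tendsto_add_atTop_iff_nat π.natDegree]
  have hr0 := rho_pos π
  have h2 := ((tendsto_pow_atTop_nhds_zero_of_lt_one hr0.le (rho_lt_one π)).comp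
    (Filter.tendsto_add_atTop_nat 1)).div_const (rho π ^ π.natDegree)
  rw [zero_div] at h2
  refine squeeze_zero_norm (fun m => ?_) h2
  rw [norm_div, add_comm m]
  have h3 := h.norm_le h1 m
  have h4 := rho_pow_le_norm_carlitzL π (π.natDegree + m + 1)
  -- Half of this exponent absorbs the factor m + 1 of |L_{δ+m+1}| ≥ ρ^(δ+m+1); the constant ρ^δ is
  -- harmless.
  have h5 : 2 * (m + 1) ≤ Fintype.card F ^ (m + 1) := by
    calc 2 * (m + 1) ≤ 2 * 2 ^ m := by
          have := Nat.lt_two_pow_self (n := m); omega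
      _ = 2 ^ (m + 1) := by ring
      _ ≤ _ := Nat.pow_le_pow_left Fintype.one_lt_card _
  have h6 : rho π ^ Fintype.card F ^ (m + 1) ≤ rho π ^ (2 * (m + 1)) :=
    pow_le_pow_of_le_one hr0.le (rho_lt_one π).le h5
  calc _ ≤ rho π ^ (2 * (m + 1)) / rho π ^ (π.natDegree + m + 1) :=
        div_le_div₀ (by positivity) (h3.trans h6) (by positivity) h4
    _ = _ := by
      simp only [Function.comp]
      field_simp
      ring

theorem TailRelations.tendsto_zero {c : ℕ → OmegaPi π} (h : TailRelations π c)
    (h1 : ‖c π.natDegree‖ ≤ 1) : Filter.Tendsto c Filter.atTop (𝓝 0) := by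
  rw [← Filter.tendsto_add_atTop_iff_nat 1]
  refine squeeze_zero_norm (fun k => ?_) (tendsto_zero_iff_norm_tendsto_zero.1 (h.tendsto_div h1))
  rw [norm_div]
  refine le_div_self (norm_nonneg _) (norm_pos_iff.2 ?_) (norm_polyToOmega_le_one π _)
  exact (map_ne_zero_iff _ (polyToOmega_injective π)).2 (carlitzL_ne_zero _)

/-- Head and tail relations obey the same Artin-Schreier recursion; the tail additionally specifies
which root is taken. -/
theorem sub_pow_card_of_relations {c : ℕ → OmegaPi π} (hH : HeadRelations π c)
    (hT : TailRelations π c) (i : ℕ) :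
    c (i + 2) - c (i + 2) ^ Fintype.card F =
      (c (i + 1) * polyToOmega π (bracket F (i + 1))) ^ Fintype.card F := by
  by_cases hi : i + 1 < π.natDegree
  · rw [mul_pow]
    linear_combination -hH.2 (i + 1) (by omega) hi
  · have h := hT (i + 2) (by omega)
    rw [show i + 2 - 1 = i + 1 by omega] at h
    refine hasSum_pow_card_pow_sub (polyToOmega π) (F := F) ?_
    simpa only [← pow_mul, ← pow_succ'] using h

/-- The sequence `c_δ, c_{δ+1}, …` determined by `c_δ = a` and the tail relations. -/
def tailSeq (π : F[X]) [Fact (Irreducible π)] (a : OmegaPi π) : ℕ → OmegaPi π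
  | 0 => a
  | m + 1 => ∑' j : ℕ, (tailSeq π a m * polyToOmega π (bracket F (π.natDegree + m))) ^
      Fintype.card F ^ (j + 1)

theorem existsUnique_of_headRelations {a : ℕ → OmegaPi π} (ha : HeadRelations π a) :
    ∃! c : ℕ → OmegaPi π, (∀ i, 1 ≤ i → i ≤ π.natDegree → c i = a i) ∧
      TailRelations π c ∧ ConstRelation π c := by
  have hδ := natDegree_pos π
  let b : ℕ → OmegaPi π := fun n =>
    if n ≤ π.natDegree then a n else tailSeq π (a π.natDegree) (n - π.natDegree)
  let S : OmegaPi π := ∑' k : ℕ,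
    (-1) ^ (k + 1 + 1) * (b (k + 1) / polyToOmega π (carlitzL F (k + 1)))
  let c : ℕ → OmegaPi π := fun n => if n = 0 then S else b n
  have hcb : ∀ n, n ≠ 0 → c n = b n := fun n hn => if_neg hn
  have hca : ∀ i, 1 ≤ i → i ≤ π.natDegree → c i = a i := by
    intro i hi hi'
    rw [hcb i (by omega)]
    exact if_pos hi'
  have hct : ∀ m, c (π.natDegree + m) = tailSeq π (a π.natDegree) m := by
    intro m
    cases m with
    | zero => exact hca _ hδ le_rfl
    | succ m =>
      rw [hcb _ (by omega)]
      have : ¬ (π.natDegree + (m + 1) ≤ π.natDegree) := by omega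
      simp only [b, if_neg this, Nat.add_sub_cancel_left]
  have h1 : ‖c π.natDegree‖ ≤ 1 := by
    rw [hca _ hδ le_rfl]; exact ha.norm_natDegree_le_one
  have htail : ∀ m n, π.natDegree + 1 ≤ n → n ≤ π.natDegree + m →
      HasSum (fun j : ℕ => (c (n - 1) * polyToOmega π (bracket F (n - 1))) ^
        Fintype.card F ^ (j + 1)) (c n) := by
    intro m
    induction m with
    | zero => intro n hn hn'; omega
    | succ m ih =>
      intro n hn hn'
      by_cases h : n ≤ π.natDegree + m
      · exact ih n hn h
      · have hn2 : n = π.natDegree + (m + 1) := by omega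
        subst hn2
        have h2 := (norm_mul_bracket_le h1 ih).1
        have h3 := summable_pow_card_pow (F := F) (h2.trans_lt
          (pow_lt_one₀ (rho_pos π).le (rho_lt_one π) (pow_ne_zero _ Fintype.card_ne_zero)))
        have h4 := ((summable_nat_add_iff 1).2 h3).hasSum
        rw [show π.natDegree + (m + 1) - 1 = π.natDegree + m by omega, hct (m + 1), tailSeq,
          ← hct m]
        exact h4
  have hT : TailRelations π c := fun n hn => htail n n hn (by omega)
  refine ⟨c, ⟨hca, hT, ?_⟩, ?_⟩
  · have h2 := hT.tendsto_div h1
    have h3 : Summable fun k : ℕ =>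
        (-1) ^ (k + 1 + 1) * (c (k + 1) / polyToOmega π (carlitzL F (k + 1))) := by
      refine summable_of_tendsto_zero ?_
      rw [tendsto_zero_iff_norm_tendsto_zero] at h2 ⊢
      simpa only [norm_mul, norm_pow, norm_neg, norm_one, one_pow, one_mul] using h2
    have h4 := h3.hasSum
    exact h4
  · rintro c' ⟨hca', hT', hC'⟩
    have hpos : ∀ n, c' (n + 1) = c (n + 1) := by
      intro n
      induction n with
      | zero => rw [hca _ le_rfl hδ, hca' _ le_rfl hδ]
      | succ n ih =>
        by_cases h : n + 2 ≤ π.natDegree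
        · rw [hca _ (by omega) h, hca' _ (by omega) h]
        · have h3 := hT' (n + 2) (by omega)
          have h4 := hT (n + 2) (by omega)
          rw [show n + 2 - 1 = n + 1 by omega] at h3 h4
          rw [ih] at h3
          exact h3.unique h4
    funext n
    cases n with
    | zero =>
      have h3 : HasSum _ (c' 0) := hC'
      simp only [hpos] at h3
      have h2 := hT.tendsto_div h1
      have h5 : c 0 = S := if_pos rfl
      rw [h5, ← h3.tsum_eq]
      simp only [S]
      refine tsum_congr fun k => ?_
      rw [hcb _ k.succ_ne_zero]
    | succ n => exact hpos n

end Relations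

/-! ### Carlitz series and the equation w - w^q = t^q for w = Δu. -/

section Equation

variable {F : Type*} [Field F] [Fintype F] {π : F[X]} [Fact (Irreducible π)]

/-- Raising to the power q is additive and injective, so nothing is lost by eliminating the root. -/
theorem carlitzD_sub_frobTau_eq_iff (u : OPi π → OmegaPi π) (t : OPi π) :
    carlitzD π u t - frobTau π (carlitzD π u) t = oToOmega π t ↔
      carlitzDelta π u t - carlitzDelta π u t ^ Fintype.card F =
        oToOmega π t ^ Fintype.card F := by
  have h := qRoot_pow π (carlitzDelta π u t)
  simp only [carlitzD, frobTau]
  set w := carlitzDelta π u t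
  rw [h]
  constructor
  · intro h1
    rw [← h1, sub_pow_card (polyToOmega π), h]
  · intro h1
    have h2 : (qRoot π w - w - oToOmega π t) ^ Fintype.card F = 0 := by
      rw [sub_pow_card (polyToOmega π), sub_pow_card (polyToOmega π), h, h1, sub_self]
    exact sub_eq_zero.1 ((pow_eq_zero_iff Fintype.card_ne_zero).1 h2)

theorem tendstoUniformly_of_hasSum {ι E : Type*} [NormedAddCommGroup E] [IsUltrametricDist E]
    {f : ℕ → ι → E} {u : ι → E} {b : ℕ → ℝ} (hb : Filter.Tendsto b Filter.atTop (𝓝 0))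
    (hf : ∀ i t, ‖f i t‖ ≤ b i) (hu : ∀ t, HasSum (fun i => f i t) (u t)) :
    TendstoUniformly (fun (N : ℕ) t => ∑ i ∈ Finset.range N, f i t) u Filter.atTop := by
  rw [Metric.tendstoUniformly_iff]
  intro ε hε
  obtain ⟨N, hN⟩ := Filter.eventually_atTop.1 (hb.eventually_lt_const (half_pos hε))
  filter_upwards [Filter.eventually_ge_atTop N] with n hn t
  rw [dist_eq_norm]
  refine lt_of_le_of_lt ?_ (half_lt_self hε)
  exact norm_le_of_hasSum ((hasSum_nat_add_iff' n).2 (hu t)) fun i =>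
    (hf _ t).trans (hN _ (by omega)).le

/-- The sum of a series in the normalized Carlitz polynomials. -/
def carlitzSum (π : F[X]) [Fact (Irreducible π)] (c : ℕ → OmegaPi π) (t : OPi π) : OmegaPi π :=
  ∑' i, c i * carF (polyToOmega π) i (oToOmega π t)

theorem norm_mul_carF_le (c : ℕ → OmegaPi π) (i : ℕ) (t : OPi π) :
    ‖c i * carF (polyToOmega π) i (oToOmega π t)‖ ≤ ‖c i‖ := by
  rw [norm_mul]
  exact mul_le_of_le_one_right (norm_nonneg _) (norm_carF_le_one π i t)

theorem hasSum_carlitzSum {c : ℕ → OmegaPi π} (hc : Filter.Tendsto c Filter.atTop (𝓝 0))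
    (t : OPi π) :
    HasSum (fun i => c i * carF (polyToOmega π) i (oToOmega π t)) (carlitzSum π c t) :=
  (summable_of_tendsto_zero (squeeze_zero_norm (fun i => norm_mul_carF_le c i t)
    (tendsto_zero_iff_norm_tendsto_zero.1 hc))).hasSum

theorem isCarlitzExpansion_carlitzSum {c : ℕ → OmegaPi π}
    (hc : Filter.Tendsto c Filter.atTop (𝓝 0)) :
    IsCarlitzExpansion π c (carlitzSum π c) := by
  simp only [IsCarlitzExpansion, carlitzF_eq]
  exact tendstoUniformly_of_hasSum (tendsto_zero_iff_norm_tendsto_zero.1 hc)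
    (norm_mul_carF_le c) (hasSum_carlitzSum hc)

theorem continuous_carlitzSum {c : ℕ → OmegaPi π}
    (hc : Filter.Tendsto c Filter.atTop (𝓝 0)) : Continuous (carlitzSum π c) := by
  refine (isCarlitzExpansion_carlitzSum hc).continuous (Filter.Frequently.of_forall fun N => ?_)
  simp only [carlitzF_eq]
  exact continuous_finsetSum _ fun i _ =>
    continuous_const.mul ((continuous_carF _ i).comp (continuous_oToOmega π))

theorem isFqLinear_carlitzSum {c : ℕ → OmegaPi π}
    (hc : Filter.Tendsto c Filter.atTop (𝓝 0)) : IsFqLinear π (carlitzSum π c) := by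
  constructor
  · intro s t
    refine (hasSum_carlitzSum hc (s + t)).unique ?_
    simpa only [map_add, carF_add, mul_add] using
      (hasSum_carlitzSum hc s).add (hasSum_carlitzSum hc t)
  · intro α t
    refine (hasSum_carlitzSum hc _).unique ?_
    simpa only [map_mul, ← polyToOmega_eq, carF_C_mul, mul_left_comm] using
      (hasSum_carlitzSum hc t).mul_left (polyToOmega π (Polynomial.C α))

theorem hasSum_carlitzDelta_carlitzSum {c : ℕ → OmegaPi π}
    (hc : Filter.Tendsto c Filter.atTop (𝓝 0)) (t : OPi π) :
    HasSum (fun i => c (i + 1) * carF (polyToOmega π) i (oToOmega π t) ^ Fintype.card F)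
      (carlitzDelta π (carlitzSum π c) t) := by
  have h := (hasSum_carlitzSum hc (polyToO π Polynomial.X * t)).sub
    ((hasSum_carlitzSum hc t).mul_left (polyToOmega π Polynomial.X))
  have h2 := (hasSum_nat_add_iff' 1).2 h
  simp only [map_mul, ← polyToOmega_eq, Finset.sum_range_one, carF_zero,
    carF_succ_X_mul _ (polyToOmega_injective π)] at h2
  rw [show c 0 * (polyToOmega π Polynomial.X * oToOmega π t) -
    polyToOmega π Polynomial.X * (c 0 * oToOmega π t) = 0 by ring, sub_zero] at h2
  refine h2.congr_fun ?_
  intro i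
  ring

theorem carlitzDelta_carlitzSum_sub_pow {c : ℕ → OmegaPi π} (hH : HeadRelations π c)
    (hT : TailRelations π c) (t : OPi π) :
    carlitzDelta π (carlitzSum π c) t -
      carlitzDelta π (carlitzSum π c) t ^ Fintype.card F = oToOmega π t ^ Fintype.card F := by
  have hc := hT.tendsto_zero hH.norm_natDegree_le_one
  have h1 := hasSum_carlitzDelta_carlitzSum hc t
  have h2 := h1.sub (hasSum_pow_card (polyToOmega π) h1)
  -- The potential of the telescoping sum: g_i = (c_{i+1} - c_{i+1}^q) f_i^q by the coefficient
  -- relations, and f_i^(q^2) = f_i^q + ([i+1] f_{i+1})^q then turns the i-th term into g_i -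
  -- g_{i+1}. The sum is g_0 = t^q since g_i → 0.
  let g : ℕ → OmegaPi π := fun i => if i = 0 then oToOmega π t ^ Fintype.card F else
    (c i * polyToOmega π (bracket F i) *
      carF (polyToOmega π) i (oToOmega π t)) ^ Fintype.card F
  have hg : ∀ i, c (i + 1) * carF (polyToOmega π) i (oToOmega π t) ^ Fintype.card F -
      (c (i + 1) * carF (polyToOmega π) i (oToOmega π t) ^ Fintype.card F) ^ Fintype.card F =
      g i - g (i + 1) := by
    intro i
    have h3 : g i = (c (i + 1) - c (i + 1) ^ Fintype.card F) *
        carF (polyToOmega π) i (oToOmega π t) ^ Fintype.card F := by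
      cases i with
      | zero =>
        rw [carF_zero, show c (0 + 1) - c (0 + 1) ^ Fintype.card F = 1 by
          linear_combination -hH.1, one_mul]
        exact if_pos rfl
      | succ i =>
        rw [sub_pow_card_of_relations hH hT i, ← mul_pow]
        exact if_neg i.succ_ne_zero
    have h4 : g (i + 1) = (c (i + 1) * polyToOmega π (bracket F (i + 1)) *
      carF (polyToOmega π) (i + 1) (oToOmega π t)) ^ Fintype.card F := if_neg i.succ_ne_zero
    have h5 := carF_pow_card (polyToOmega π) (polyToOmega_injective π) i (oToOmega π t)
    rw [h3, h4, mul_pow (c (i + 1)) (_ ^ _)]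
    rw [show (carF (polyToOmega π) i (oToOmega π t) ^ Fintype.card F) ^ Fintype.card F =
      carF (polyToOmega π) i (oToOmega π t) ^ Fintype.card F +
        (polyToOmega π (bracket F (i + 1)) *
          carF (polyToOmega π) (i + 1) (oToOmega π t)) ^ Fintype.card F by
        rw [← add_pow_card (polyToOmega π), ← h5]]
    ring
  simp only [hg] at h2
  have h6 := h2.tendsto_sum_nat
  simp only [Finset.sum_range_sub'] at h6
  have h7 : Filter.Tendsto g Filter.atTop (𝓝 0) := by
    have h8 := (tendsto_zero_iff_norm_tendsto_zero.1 hc).pow (Fintype.card F)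
    rw [zero_pow Fintype.card_ne_zero] at h8
    refine squeeze_zero_norm' ?_ h8
    filter_upwards [Filter.eventually_ne_atTop 0] with i hi
    have : g i = _ := if_neg hi
    rw [this, norm_pow]
    gcongr
    rw [mul_right_comm, norm_mul]
    exact (mul_le_of_le_one_right (norm_nonneg _) (norm_polyToOmega_le_one π _)).trans
      (norm_mul_carF_le c i t)
  have h9 := h7.const_sub (g 0)
  rw [sub_zero] at h9
  exact tendsto_nhds_unique h6 h9

end Equation

/-! ### Linear functions on O_π. -/

section Linear

variable {F : Type*} [Field F] [Fintype F] {π : F[X]} [Fact (Irreducible π)]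
  {u v : OPi π → OmegaPi π}

theorem IsFqLinear.map_zero (h : IsFqLinear π u) : u 0 = 0 := by
  have := h.1 0 0
  rwa [add_zero, left_eq_add] at this

theorem IsFqLinear.sub (hu : IsFqLinear π u) (hv : IsFqLinear π v) :
    IsFqLinear π (fun t => u t - v t) := by
  refine ⟨fun s t => ?_, fun α t => ?_⟩
  · simp only [hu.1, hv.1]; ring
  · simp only [hu.2, hv.2]; ring

theorem IsFqLinear.comp_mul (hu : IsFqLinear π u) (a : OPi π) :
    IsFqLinear π (fun t => u (a * t)) := by
  refine ⟨fun s t => ?_, fun α t => ?_⟩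
  · simp only [mul_add, hu.1]
  · simp only [← hu.2, mul_left_comm]

theorem IsFqLinear.const_mul (hu : IsFqLinear π u) (a : OmegaPi π) :
    IsFqLinear π (fun t => a * u t) := by
  refine ⟨fun s t => ?_, fun α t => ?_⟩
  · simp only [mul_add, hu.1]
  · simp only [hu.2, mul_left_comm]

theorem IsFqLinear.carlitzDelta (hu : IsFqLinear π u) : IsFqLinear π (carlitzDelta π u) :=
  (hu.comp_mul _).sub (hu.const_mul _)

theorem carlitzDelta_sub (u v : OPi π → OmegaPi π) (t : OPi π) :
    carlitzDelta π (fun s => u s - v s) t = carlitzDelta π u t - carlitzDelta π v t := by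
  simp only [carlitzDelta]; ring

/-- An `F`-linear function killed by `Δ` is `F[x]`-linear. -/
theorem IsFqLinear.polyToO_mul (hu : IsFqLinear π u) (h : ∀ t, CarlitzPlace.carlitzDelta π u t = 0)
    (p : F[X]) (t : OPi π) : u (polyToO π p * t) = polyToOmega π p * u t := by
  induction p using Polynomial.induction_on generalizing t with
  | C a => exact hu.2 a t
  | add p q hp hq => rw [map_add, map_add, add_mul, add_mul, hu.1, hp, hq]
  | monomial n a ih =>
    rw [pow_succ, ← mul_assoc, map_mul (polyToO π) _ Polynomial.X, mul_assoc, ih,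
      map_mul (polyToOmega π) _ Polynomial.X, mul_assoc]
    congr 1
    exact sub_eq_zero.1 (h t)

/-- O_π is the sum of πO_π and the F-span of 1, x, …, x^(δ-1), by approximation and division with
remainder. -/
theorem IsFqLinear.eq_zero (hu : IsFqLinear π u) (hπ : π.Monic)
    (h : ∀ t, u (polyToO π π * t) = 0)
    (hX : ∀ j < π.natDegree, u (polyToO π (Polynomial.X ^ j)) = 0) (t : OPi π) : u t = 0 := by
  have hsum : ∀ (s : Finset ℕ) (p : F[X]), (∀ j ∈ s, j < π.natDegree) →
      u (polyToO π (∑ j ∈ s, Polynomial.C (p.coeff j) * Polynomial.X ^ j)) = 0 := by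
    intro s p
    induction s using Finset.induction_on with
    | empty => intro _; simpa using hu.map_zero
    | insert a s ha ih =>
      intro hs
      rw [Finset.sum_insert ha, map_add, hu.1, ih fun j hj => hs j (Finset.mem_insert_of_mem hj),
        map_mul, hu.2, hX a (hs a (Finset.mem_insert_self a s)), mul_zero, add_zero]
  obtain ⟨p, s, hs⟩ := exists_eq_polyToO_add_pow_mul π t 1
  have h1 := Polynomial.modByMonic_add_div p π
  have h2 : t = polyToO π (p %ₘ π) + polyToO π π * (polyToO π (p /ₘ π) + s) := by
    nth_rewrite 1 [hs, ← h1]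
    rw [map_add, map_mul]
    ring
  have h3 : (p %ₘ π).natDegree < π.natDegree :=
    Polynomial.natDegree_modByMonic_lt p hπ (Fact.out : Irreducible π).ne_one
  rw [h2, hu.1, h, add_zero, Polynomial.as_sum_range_C_mul_X_pow' (p %ₘ π) h3]
  exact hsum _ _ fun j hj => Finset.mem_range.1 hj

end Linear

/-! ### Comparison of the Carlitz series with the logarithm on πO_π. -/

section Logarithm

variable {F : Type*} [Field F] [Fintype F] {π : F[X]} [Fact (Irreducible π)]

theorem norm_polyToO_mul_le (s : OPi π) : ‖oToOmega π (polyToO π π * s)‖ ≤ rho π := by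
  rw [map_mul, norm_mul, ← polyToOmega_eq, norm_polyToOmega_self]
  exact mul_le_of_le_one_right (rho_pos π).le (norm_oToOmega_le_one π s)

theorem exists_eq_polyToO_mul {t : OPi π} (ht : ‖(t : KPi π)‖ ≤ rho π) :
    ∃ s, t = polyToO π π * s := by
  have h0 : polyToK π π ≠ 0 :=
    (map_ne_zero_iff _ (polyToK_injective π)).2 (Fact.out : Irreducible π).ne_zero
  refine ⟨⟨(t : KPi π) / polyToK π π, ?_⟩, Subtype.ext ?_⟩
  · change ‖_‖ ≤ 1
    rw [norm_div, norm_polyToK_self]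
    exact (div_le_one (rho_pos π)).2 ht
  · exact (mul_div_cancel₀ (t : KPi π) h0).symm

/-- The sum of the logarithm series `∑ t ^ (q ^ n) / [n]`. -/
def logSum (π : F[X]) [Fact (Irreducible π)] (t : OPi π) : OmegaPi π :=
  ∑' n : ℕ, oToOmega π t ^ Fintype.card F ^ (n + 1) / polyToOmega π (bracket F (n + 1))

theorem norm_logTerm_le (t : OPi π) (n : ℕ) :
    ‖oToOmega π t ^ Fintype.card F ^ (n + 1) / polyToOmega π (bracket F (n + 1))‖ ≤
      ‖oToOmega π t‖ ^ Fintype.card F ^ (n + 1) / rho π := by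
  rw [norm_div, norm_pow]
  exact div_le_div_of_nonneg_left (by positivity) (rho_pos π)
    (rho_le_norm_bracket π n.succ_ne_zero)

theorem hasSum_logSum {t : OPi π} (ht : ‖oToOmega π t‖ ≤ rho π) :
    HasSum (fun n : ℕ => oToOmega π t ^ Fintype.card F ^ (n + 1) /
      polyToOmega π (bracket F (n + 1))) (logSum π t) := by
  refine (summable_of_tendsto_zero ?_).hasSum
  have h := ((tendsto_pow_pow_zero (Fintype.one_lt_card (α := F)) (norm_nonneg _)
    (ht.trans_lt (rho_lt_one π))).comp (Filter.tendsto_add_atTop_nat 1)).div_const (rho π)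
  rw [zero_div] at h
  exact squeeze_zero_norm (norm_logTerm_le t) h

/-- All exponents are at least q ≥ 2, so the logarithm vanishes to second order at 0. -/
theorem norm_logSum_le {t : OPi π} (ht : ‖oToOmega π t‖ ≤ rho π) :
    ‖logSum π t‖ ≤ ‖oToOmega π t‖ ^ 2 / rho π := by
  refine norm_le_of_hasSum (hasSum_logSum ht) fun n => (norm_logTerm_le t n).trans ?_
  refine div_le_div_of_nonneg_right ?_ (rho_pos π).le
  refine pow_le_pow_of_le_one (norm_nonneg _) (norm_oToOmega_le_one π t) ?_
  calc 2 ≤ Fintype.card F := Fintype.one_lt_card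
    _ ≤ _ := Nat.le_self_pow n.succ_ne_zero _

theorem isFqLinear_logSum_mul : IsFqLinear π (fun s => logSum π (polyToO π π * s)) := by
  constructor
  · intro s t
    refine (hasSum_logSum (norm_polyToO_mul_le (s + t))).unique ?_
    have h := (hasSum_logSum (norm_polyToO_mul_le s)).add (hasSum_logSum (norm_polyToO_mul_le t))
    simpa only [← add_div, ← add_pow_card_pow (polyToOmega π), ← map_add, ← mul_add] using h
  · intro α t
    refine (hasSum_logSum (norm_polyToO_mul_le _)).unique ?_
    have h := (hasSum_logSum (norm_polyToO_mul_le t)).mul_left (polyToOmega π (Polynomial.C α))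
    refine h.congr_fun fun n => ?_
    rw [mul_left_comm, map_mul, ← polyToOmega_eq, mul_pow, C_pow_card_pow, mul_div_assoc]

/-- Δ multiplies t^(q^n) by [n], which cancels the denominators. -/
theorem hasSum_carlitzDelta_logSum (s : OPi π) :
    HasSum (fun n : ℕ => oToOmega π (polyToO π π * s) ^ Fintype.card F ^ (n + 1))
      (carlitzDelta π (fun s => logSum π (polyToO π π * s)) s) := by
  have h := (hasSum_logSum (norm_polyToO_mul_le (polyToO π Polynomial.X * s))).sub
    ((hasSum_logSum (norm_polyToO_mul_le s)).mul_left (polyToOmega π Polynomial.X))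
  refine h.congr_fun fun n => ?_
  have hb : polyToOmega π (bracket F (n + 1)) ≠ 0 :=
    (map_ne_zero_iff _ (polyToOmega_injective π)).2 (bracket_ne_zero n.succ_ne_zero)
  rw [mul_left_comm, map_mul _ (polyToO π Polynomial.X), ← polyToOmega_eq, mul_pow]
  rw [eq_sub_iff_add_eq, eq_div_iff hb, bracket_map]
  rw [bracket_map] at hb
  field_simp
  ring

/-- The difference d satisfies d^q = d and |d| < 1, hence d = 0. -/
theorem eq_of_sub_pow_card_eq {A : Type*} [NormedField A] [IsUltrametricDist A] (ψ : F[X] →+* A)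
    {a b : A} (ha : ‖a‖ < 1) (hb : ‖b‖ < 1)
    (h : a - a ^ Fintype.card F = b - b ^ Fintype.card F) : a = b := by
  have h1 : (a - b) ^ Fintype.card F = a - b := by
    rw [sub_pow_card ψ]; linear_combination -h
  have h2 : ‖a - b‖ < 1 := by
    have := IsUltrametricDist.norm_add_le_max a (-b)
    rw [norm_neg, ← sub_eq_add_neg] at this
    exact this.trans_lt (max_lt ha hb)
  by_contra hne
  have h3 := pow_lt_self_of_lt_one₀ (norm_pos_iff.2 (sub_ne_zero.2 hne)) h2
    (Fintype.one_lt_card (α := F))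
  rw [← norm_pow, h1] at h3
  exact lt_irrefl _ h3

/-- In Σ c_{i+1} f_i^q, the terms with i < δ are small because L_i is a unit there, so |f_i(t)| ≤
|t|; the others because the tail relations make c_{i+1} small. -/
theorem norm_carlitzDelta_carlitzSum_le {c : ℕ → OmegaPi π} (hH : HeadRelations π c)
    (hT : TailRelations π c) {t : OPi π} (ht : ‖oToOmega π t‖ ≤ rho π) :
    ‖carlitzDelta π (carlitzSum π c) t‖ ≤ rho π := by
  have h1 := hH.norm_natDegree_le_one
  refine norm_le_of_hasSum (hasSum_carlitzDelta_carlitzSum (hT.tendsto_zero h1) t) fun i => ?_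
  rw [norm_mul, norm_pow]
  have hf := norm_carF_le_one π i t
  by_cases hi : i < π.natDegree
  · have h2 := norm_carF_le_div π i t
    rw [norm_carlitzL_eq_one π hi, div_one] at h2
    refine (mul_le_of_le_one_left (by positivity) (hH.norm_le_one hi)).trans ?_
    exact (pow_le_of_le_one (norm_nonneg _) hf Fintype.card_ne_zero).trans (h2.trans ht)
  · obtain ⟨m, rfl⟩ := Nat.exists_eq_add_of_le (not_lt.1 hi)
    refine (mul_le_of_le_one_right (norm_nonneg _) (pow_le_one₀ (norm_nonneg _) hf)).trans ?_
    exact (hT.norm_le h1 m).trans (pow_le_of_le_one (rho_pos π).le (rho_lt_one π).le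
      (pow_ne_zero _ Fintype.card_ne_zero))

/-- The sum of the Carlitz series has derivative zero at the origin. -/
theorem tendsto_carlitzSum_div {c : ℕ → OmegaPi π} (h1 : ‖c π.natDegree‖ ≤ 1)
    (hT : TailRelations π c) (hC : ConstRelation π c)
    {s : ℕ → OPi π} (hs0 : ∀ n, oToOmega π (s n) ≠ 0)
    (hs : Filter.Tendsto (fun n => oToOmega π (s n)) Filter.atTop (𝓝 0)) :
    Filter.Tendsto (fun n => carlitzSum π c (s n) / oToOmega π (s n)) Filter.atTop (𝓝 0) := by
  have hb : Filter.Tendsto (fun i => ‖c i / polyToOmega π (carlitzL F i)‖) Filter.atTop (𝓝 0) :=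
    tendsto_zero_iff_norm_tendsto_zero.1
      ((Filter.tendsto_add_atTop_iff_nat 1).1 (hT.tendsto_div h1))
  have hu := tendstoUniformly_of_hasSum
    (f := fun i n => c i * carF (polyToOmega π) i (oToOmega π (s n)) / oToOmega π (s n))
    (u := fun n => carlitzSum π c (s n) / oToOmega π (s n)) hb (fun i n => ?_)
    (fun n => (hasSum_carlitzSum (hT.tendsto_zero h1) (s n)).div_const _)
  · refine TendstoUniformlyOnFilter.tendsto_of_eventually_tendsto
      (hu.tendstoUniformlyOnFilter.mono_right le_top)
      (L := fun N => ∑ i ∈ Finset.range N, c i * ((-1) ^ i / polyToOmega π (carlitzL F i)))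
      (Filter.Eventually.of_forall fun N => ?_) ?_
    · refine tendsto_finsetSum _ fun i _ => ?_
      simp only [mul_div_assoc]
      exact (tendsto_carF_div π hs0 hs i).const_mul _
    · have h2 : HasSum (fun i => c i * ((-1) ^ i / polyToOmega π (carlitzL F i))) 0 := by
        rw [← hasSum_nat_add_iff' 1]
        have h3 : HasSum _ (c 0) := hC
        have h4 := h3.neg
        simp only [Finset.sum_range_one, pow_zero, carlitzL, Finset.range_zero, Finset.prod_empty,
          map_one, div_one, mul_one, zero_sub]
        refine h4.congr_fun fun k => ?_
        rw [carlitzL, pow_succ _ (k + 1)]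
        ring
      exact h2.tendsto_sum_nat
  · have h2 := norm_carF_le_div π i (s n)
    have h3 := norm_pos_iff.2 (hs0 n)
    rw [norm_div, norm_mul, norm_div]
    rw [div_le_iff₀ h3, div_mul_eq_mul_div, ← mul_div_assoc']
    gcongr

theorem carlitzSum_mul_eq_logSum {c : ℕ → OmegaPi π} (hH : HeadRelations π c)
    (hT : TailRelations π c) (hC : ConstRelation π c) (t : OPi π) :
    carlitzSum π c (polyToO π π * t) = logSum π (polyToO π π * t) := by
  have h1 := hH.norm_natDegree_le_one
  have hlin := isFqLinear_carlitzSum (hT.tendsto_zero h1)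
  have hy := (hlin.comp_mul (polyToO π π)).sub isFqLinear_logSum_mul
  have hρ := rho_lt_one π
  set y : OPi π → OmegaPi π :=
    fun t => carlitzSum π c (polyToO π π * t) - logSum π (polyToO π π * t) with hydef
  have hΔ : ∀ s, carlitzDelta π y s = 0 := by
    intro s
    rw [hydef, carlitzDelta_sub, sub_eq_zero]
    have hs := norm_polyToO_mul_le s
    have hw : carlitzDelta π (fun s => carlitzSum π c (polyToO π π * s)) s =
        carlitzDelta π (carlitzSum π c) (polyToO π π * s) := by
      simp only [carlitzDelta, mul_left_comm]
    have h3 := hasSum_carlitzDelta_logSum s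
    have h4 : ‖oToOmega π (polyToO π π * s) ^ Fintype.card F‖ < 1 := by
      rw [norm_pow]
      exact pow_lt_one₀ (norm_nonneg _) (hs.trans_lt hρ) Fintype.card_ne_zero
    -- Regrouped as a series in b = (πs)^q, the sum is Σ b^(q^n), the small root of w - w^q = b.
    simp only [pow_succ', pow_mul] at h3
    rw [hw]
    refine eq_of_sub_pow_card_eq (polyToOmega π)
      ((norm_carlitzDelta_carlitzSum_le hH hT hs).trans_lt hρ) ?_ ?_
    · refine (norm_le_of_hasSum h3 fun n => ?_).trans_lt h4
      rw [norm_pow]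
      exact pow_le_of_le_one (norm_nonneg _) h4.le (pow_ne_zero _ Fintype.card_ne_zero)
    · rw [carlitzDelta_carlitzSum_sub_pow hH hT, hasSum_pow_card_pow_sub (polyToOmega π) h3]
  rw [← sub_eq_zero]
  change y t = 0
  by_cases ht : t = 0
  · rw [ht, hy.map_zero]
  have hπ0 : polyToOmega π π ≠ 0 :=
    (map_ne_zero_iff _ (polyToOmega_injective π)).2 (Fact.out : Irreducible π).ne_zero
  have ht0 : oToOmega π t ≠ 0 := (map_ne_zero_iff _ (oToOmega_injective π)).2 ht
  let s : ℕ → OPi π := fun N => polyToO π π * (polyToO π (π ^ N) * t)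
  have hs : ∀ N, oToOmega π (s N) = polyToOmega π π ^ (N + 1) * oToOmega π t := by
    intro N
    simp only [s, map_mul, map_pow, ← polyToOmega_eq]
    ring
  have hs0 : ∀ N, oToOmega π (s N) ≠ 0 := fun N => by
    rw [hs]; exact mul_ne_zero (pow_ne_zero _ hπ0) ht0
  have hs1 : Filter.Tendsto (fun N => oToOmega π (s N)) Filter.atTop (𝓝 0) := by
    simp only [hs]
    have := ((tendsto_pow_atTop_nhds_zero_of_norm_lt_one
      ((norm_polyToOmega_self π).trans_lt hρ)).comp (Filter.tendsto_add_atTop_nat 1)).mul_const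
        (oToOmega π t)
    rwa [zero_mul] at this
  have hlog : Filter.Tendsto (fun N => logSum π (s N) / oToOmega π (s N)) Filter.atTop
      (𝓝 0) := by
    have h5 := (tendsto_zero_iff_norm_tendsto_zero.1 hs1).div_const (rho π)
    rw [zero_div] at h5
    refine squeeze_zero_norm (fun N => ?_) h5
    rw [norm_div, div_le_iff₀ (norm_pos_iff.2 (hs0 N))]
    refine (norm_logSum_le (norm_polyToO_mul_le _)).trans_eq ?_
    ring
  have h6 := (tendsto_carlitzSum_div h1 hT hC hs0 hs1).sub hlog
  rw [sub_zero] at h6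
  -- F[x]-linearity of y makes this quotient independent of N, while it tends to 0.
  have h7 : ∀ N, carlitzSum π c (s N) / oToOmega π (s N) - logSum π (s N) / oToOmega π (s N) =
      y t / (polyToOmega π π * oToOmega π t) := by
    intro N
    have h8 := hy.polyToO_mul hΔ (π ^ N) t
    have h9 : carlitzSum π c (s N) - logSum π (s N) = polyToOmega π (π ^ N) * y t := h8
    rw [← sub_div, h9, hs, map_pow, pow_succ]
    field_simp
  simp only [h7] at h6
  have h8 := tendsto_nhds_unique h6 tendsto_const_nhds
  exact (div_eq_zero_iff.1 h8.symm).resolve_right (mul_ne_zero hπ0 ht0)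

theorem carlitzSum_mem_logExtensions {c : ℕ → OmegaPi π} (hH : HeadRelations π c)
    (hT : TailRelations π c) (hC : ConstRelation π c) :
    carlitzSum π c ∈ logExtensions π := by
  have hc := hT.tendsto_zero hH.norm_natDegree_le_one
  refine ⟨continuous_carlitzSum hc, isFqLinear_carlitzSum hc, fun t => ?_, fun t ht => ?_⟩
  · exact (carlitzD_sub_frobTau_eq_iff _ t).2 (carlitzDelta_carlitzSum_sub_pow hH hT t)
  · obtain ⟨s, rfl⟩ := exists_eq_polyToO_mul ht
    rw [carlitzSum_mul_eq_logSum hH hT hC]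
    exact hasSum_logSum (norm_polyToO_mul_le s)

end Logarithm

/-! ### Uniqueness of expansions and the number of solutions. -/

section Counting

variable {F : Type*} [Field F] [Fintype F] {π : F[X]} [Fact (Irreducible π)]

/-- At x^k the series stops at i = k, where f_k takes the value 1, so the coefficients can be read
off recursively. -/
theorem IsCarlitzExpansion.apply_X_pow {c : ℕ → OmegaPi π} {u : OPi π → OmegaPi π}
    (h : IsCarlitzExpansion π c u) (k : ℕ) :
    u (polyToO π (Polynomial.X ^ k)) =
      ∑ i ∈ Finset.range k, c i * carlitzF π i (polyToO π (Polynomial.X ^ k)) + c k := by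
  have h1 := h.tendsto_at (polyToO π (Polynomial.X ^ k))
  refine tendsto_nhds_unique h1 (tendsto_const_nhds.congr' ?_)
  filter_upwards [Filter.eventually_ge_atTop (k + 1)] with N hN
  rw [← Finset.sum_subset (Finset.range_mono hN), Finset.sum_range_succ, carlitzF_eq π k,
    ← polyToOmega_eq, map_pow (polyToOmega π), carF_X_pow _ (polyToOmega_injective π), mul_one]
  intro i _ hi
  rw [carlitzF_eq, ← polyToOmega_eq, carF_of_degree_lt, mul_zero]
  rw [Polynomial.degree_X_pow]
  rw [Finset.mem_range] at hi
  exact_mod_cast (by omega : k < i)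

theorem IsCarlitzExpansion.unique {c c' : ℕ → OmegaPi π} {u : OPi π → OmegaPi π}
    (h : IsCarlitzExpansion π c u) (h' : IsCarlitzExpansion π c' u) : c = c' := by
  funext k
  induction k using Nat.strong_induction_on with
  | _ k ih =>
    have h1 := (h.apply_X_pow k).symm.trans (h'.apply_X_pow k)
    rw [Finset.sum_congr rfl fun i hi => by rw [ih i (Finset.mem_range.1 hi)]] at h1
    exact add_left_cancel h1

/-- A root of `z - z ^ q = a`. -/
def artinSchreierRoot (a : OmegaPi π) : OmegaPi π := (exists_sub_pow_card_eq π a).choose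

theorem artinSchreierRoot_spec (a : OmegaPi π) :
    artinSchreierRoot a - artinSchreierRoot a ^ Fintype.card F = a :=
  (exists_sub_pow_card_eq π a).choose_spec

/-- A solution of the head relations, parametrized by the choice of roots. -/
def headSeq (π : F[X]) [Fact (Irreducible π)] (ε : ℕ → F) : ℕ → OmegaPi π
  | 0 => 0
  | n + 1 => artinSchreierRoot (if n = 0 then 1 else
      (polyToOmega π (bracket F n) * headSeq π ε n) ^ Fintype.card F) +
        polyToOmega π (Polynomial.C (ε n))

theorem headSeq_succ_sub_pow (ε : ℕ → F) (n : ℕ) :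
    headSeq π ε (n + 1) - headSeq π ε (n + 1) ^ Fintype.card F = if n = 0 then 1 else
      (polyToOmega π (bracket F n) * headSeq π ε n) ^ Fintype.card F := by
  rw [headSeq, add_pow_card (polyToOmega π), C_pow_card, add_sub_add_right_eq_sub,
    artinSchreierRoot_spec]

theorem headRelations_headSeq (ε : ℕ → F) : HeadRelations π (headSeq π ε) := by
  constructor
  · have h := headSeq_succ_sub_pow (π := π) ε 0
    rw [if_pos rfl] at h
    linear_combination -h
  · intro i hi _
    have h := headSeq_succ_sub_pow (π := π) ε i
    rw [if_neg (by omega), mul_pow] at h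
    linear_combination -h

theorem eq_of_headSeq_eq {ε ε' : ℕ → F} {n : ℕ} (h : headSeq π ε n = headSeq π ε' n)
    (h' : headSeq π ε (n + 1) = headSeq π ε' (n + 1)) : ε n = ε' n := by
  rw [headSeq, headSeq, h] at h'
  exact Polynomial.C_injective (polyToOmega_injective π (add_left_cancel h'))

theorem exists_injective_to_logExtensions (π : F[X]) [Fact (Irreducible π)] :
    ∃ f : (Fin π.natDegree → F) → logExtensions π, Function.Injective f ∧
      ∀ e, ∃ c : ℕ → OmegaPi π, IsCarlitzExpansion π c (f e) ∧ HeadRelations π c ∧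
        TailRelations π c ∧ ConstRelation π c := by
  have key : ∀ e : Fin π.natDegree → F, ∃ c : ℕ → OmegaPi π,
      (∀ i, 1 ≤ i → i ≤ π.natDegree →
        c i = headSeq π (fun n => if h : n < π.natDegree then e ⟨n, h⟩ else 0) i) ∧
      HeadRelations π c ∧ TailRelations π c ∧ ConstRelation π c := by
    intro e
    have hh := headRelations_headSeq (π := π)
      (fun n => if h : n < π.natDegree then e ⟨n, h⟩ else 0)
    obtain ⟨c, ⟨hc, hT, hC⟩, -⟩ := existsUnique_of_headRelations hh
    refine ⟨c, hc, ⟨?_, fun i hi hi' => ?_⟩, hT, hC⟩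
    · rw [hc 1 le_rfl (natDegree_pos π)]
      exact hh.1
    · rw [hc i hi hi'.le, hc (i + 1) (by omega) hi']
      exact hh.2 i hi hi'
  choose c hc hH hT hC using key
  have hexp : ∀ e, IsCarlitzExpansion π (c e) (carlitzSum π (c e)) := fun e =>
    isCarlitzExpansion_carlitzSum ((hT e).tendsto_zero (hH e).norm_natDegree_le_one)
  refine ⟨fun e => ⟨carlitzSum π (c e), carlitzSum_mem_logExtensions (hH e) (hT e) (hC e)⟩,
    fun e e' h => ?_, fun e => ⟨c e, hexp e, hH e, hT e, hC e⟩⟩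
  have h1 : carlitzSum π (c e) = carlitzSum π (c e') := congrArg Subtype.val h
  have h2 : c e = c e' := (hexp e).unique (h1 ▸ hexp e')
  have h3 : ∀ i, i ≤ π.natDegree →
      headSeq π (fun n => if h : n < π.natDegree then e ⟨n, h⟩ else 0) i =
        headSeq π (fun n => if h : n < π.natDegree then e' ⟨n, h⟩ else 0) i := by
    intro i hi
    cases i with
    | zero => rfl
    | succ i => rw [← hc e _ (by omega) hi, ← hc e' _ (by omega) hi, h2]
  funext ⟨n, hn⟩
  simpa [hn] using eq_of_headSeq_eq (h3 n hn.le) (h3 (n + 1) hn)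

/-- A solution is encoded by the values of Δu - Δu₀ at 1, x, …, x^(δ-1), which satisfy z^q = z and
so lie in F. If two solutions have the same code, Δ of their difference y vanishes at these powers,
and on πO_π because y does; so Δy = 0, y is F[x]-linear, and π y(t) = y(πt) = 0. -/
theorem exists_injective_from_logExtensions (hπ : π.Monic) (u₀ : logExtensions π) :
    ∃ g : logExtensions π → (Fin π.natDegree → F), Function.Injective g := by
  have hΔ : ∀ u : logExtensions π, ∀ t, carlitzDelta π u t - carlitzDelta π u t ^ Fintype.card F =
      oToOmega π t ^ Fintype.card F := fun u t =>
    (carlitzD_sub_frobTau_eq_iff _ t).1 (u.2.2.2.1 t)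
  have key : ∀ (u : logExtensions π) (j : Fin π.natDegree), ∃ α : F,
      carlitzDelta π u (polyToO π (Polynomial.X ^ (j : ℕ))) -
        carlitzDelta π u₀ (polyToO π (Polynomial.X ^ (j : ℕ))) =
          polyToOmega π (Polynomial.C α) := by
    intro u j
    refine exists_C_of_pow_card_eq (polyToOmega π) ?_
    rw [sub_pow_card (polyToOmega π)]
    linear_combination hΔ u₀ (polyToO π (Polynomial.X ^ (j : ℕ))) -
      hΔ u (polyToO π (Polynomial.X ^ (j : ℕ)))
  choose g hg using key
  refine ⟨g, fun u v huv => ?_⟩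
  have hy := u.2.2.1.sub v.2.2.1
  have hyπ : ∀ t, u.1 (polyToO π π * t) - v.1 (polyToO π π * t) = 0 := by
    intro t
    have ht : ‖((polyToO π π * t : OPi π) : KPi π)‖ ≤ rho π := by
      rw [← norm_oToOmega]; exact norm_polyToO_mul_le t
    exact sub_eq_zero.2 ((u.2.2.2.2 _ ht).unique (v.2.2.2.2 _ ht))
  have hΔ0 : ∀ t, carlitzDelta π (fun t => u.1 t - v.1 t) t = 0 := by
    refine hy.carlitzDelta.eq_zero hπ (fun t => ?_) fun j hj => ?_
    · simp only [carlitzDelta]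
      rw [mul_left_comm, hyπ, hyπ, mul_zero, sub_zero]
    · rw [carlitzDelta_sub]
      have h1 := hg u ⟨j, hj⟩
      rw [huv] at h1
      linear_combination h1 - hg v ⟨j, hj⟩
  refine Subtype.ext (funext fun t => ?_)
  have h1 : u.1 (polyToO π π * t) - v.1 (polyToO π π * t) =
      polyToOmega π π * (u.1 t - v.1 t) := hy.polyToO_mul hΔ0 π t
  rw [hyπ] at h1
  exact sub_eq_zero.1 ((mul_eq_zero.1 h1.symm).resolve_left
    ((map_ne_zero_iff _ (polyToOmega_injective π)).2 (Fact.out : Irreducible π).ne_zero))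

theorem encard_logExtensions_and_exists_expansion (hπ : π.Monic) :
    (logExtensions π).encard = (Fintype.card F ^ π.natDegree : ℕ) ∧
      ∀ u ∈ logExtensions π, ∃ c : ℕ → OmegaPi π, IsCarlitzExpansion π c u ∧
        HeadRelations π c ∧ TailRelations π c ∧ ConstRelation π c := by
  obtain ⟨f, hf, hfc⟩ := exists_injective_to_logExtensions π
  obtain ⟨g, hg⟩ := exists_injective_from_logExtensions hπ (f 0)
  have : Finite (logExtensions π) := Finite.of_injective g hg
  -- The injection back bounds the cardinality of the solution set by that of F^δ, so every solution
  -- is one of the series already built, with all its relations.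
  have hbij : Function.Bijective f :=
    hf.bijective_of_nat_card_le (Nat.card_le_card_of_injective g hg)
  refine ⟨?_, fun u hu => ?_⟩
  · rw [Set.encard, ← ENat.card_congr (Equiv.ofBijective f hbij), ENat.card_eq_coe_fintype_card]
    simp
  · obtain ⟨e, he⟩ := hbij.2 ⟨u, hu⟩
    obtain ⟨c, hc⟩ := hfc e
    rw [he] at hc
    exact ⟨c, hc⟩

end Counting
end CarlitzPlace

end

theorem theorem1 {F : Type*} [Field F] [Fintype F] (π : Polynomial F) [Fact (Irreducible π)]
    (hmonic : π.Monic) :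
    -- there are exactly `q ^ δ` solutions
    (CarlitzPlace.logExtensions π).encard = (Fintype.card F ^ π.natDegree : ℕ) ∧
    -- each solution has a unique expansion in the Carlitz polynomials, and its coefficients
    -- satisfy all the relations
    (∀ u ∈ CarlitzPlace.logExtensions π, ∃! c : ℕ → CarlitzPlace.OmegaPi π,
      CarlitzPlace.IsCarlitzExpansion π c u) ∧
    (∀ u ∈ CarlitzPlace.logExtensions π, ∀ c : ℕ → CarlitzPlace.OmegaPi π,
      CarlitzPlace.IsCarlitzExpansion π c u →
        CarlitzPlace.HeadRelations π c ∧ CarlitzPlace.TailRelations π c ∧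
          CarlitzPlace.ConstRelation π c) ∧
    -- arbitrary roots `c_1, …, c_δ` extend to exactly one sequence satisfying all the relations
    -- (in particular the series involved converge)
    (∀ a : ℕ → CarlitzPlace.OmegaPi π, CarlitzPlace.HeadRelations π a →
      ∃! c : ℕ → CarlitzPlace.OmegaPi π,
        (∀ i, 1 ≤ i → i ≤ π.natDegree → c i = a i) ∧
          CarlitzPlace.TailRelations π c ∧ CarlitzPlace.ConstRelation π c) ∧
    -- and every sequence satisfying all the relations gives a solution
    (∀ c : ℕ → CarlitzPlace.OmegaPi π,
      CarlitzPlace.HeadRelations π c → CarlitzPlace.TailRelations π c →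
        CarlitzPlace.ConstRelation π c →
          ∃ u ∈ CarlitzPlace.logExtensions π, CarlitzPlace.IsCarlitzExpansion π c u) := by
  obtain ⟨hcard, hexp⟩ := CarlitzPlace.encard_logExtensions_and_exists_expansion hmonic
  refine ⟨hcard, fun u hu => ?_, fun u hu c hc => ?_, fun a ha => ?_, fun c hH hT hC => ?_⟩
  · obtain ⟨c, hc, -⟩ := hexp u hu
    exact ⟨c, hc, fun c' hc' => hc'.unique hc⟩
  · obtain ⟨c', hc', h⟩ := hexp u hu
    rwa [hc.unique hc']
  · exact CarlitzPlace.existsUnique_of_headRelations ha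
  · exact ⟨_, CarlitzPlace.carlitzSum_mem_logExtensions hH hT hC,
      CarlitzPlace.isCarlitzExpansion_carlitzSum (hT.tendsto_zero hH.norm_natDegree_le_one)⟩
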